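/- **Setting.** Let $n,H\ge 1$. Consider the system, with state, input and measurement in $\mathbb R^n$, $$x_{t+1}=x_t+u_t+w_t,\qquad y_t=x_t+m_t+\epsilon_t,$$ where $w_t\in\mathcal W$ and $m_t\in\mathcal M$ are arbitrary random variables with $\|w\|\le r_w$ on $\mathcal W$ and $\|m\|\le r_m$ on $\mathcal M$. A random vector $\xi$ is called $\mathcal{SG}(0,\Sigma)$ if $\mathbb E\,e^{\lambda^\top \xi}\le e^{\lambda^\top\Sigma\lambda/2}$ for all $\lambda$. There is a filtration $(\mathfrak F_t)_{t\ge0}$ such that $x_0,\hat x_0$ are $\mathfrak F_0$-measurable, $\epsilon_t$ is $\mathfrak F_t$-measurable, and $\epsilon_{t+1}$ is $\mathcal{SG}(0,\Sigma_\epsilon)$ conditionally on $\mathfrak F_t$, with $\Sigma_\epsilon\succ0$ (so $m_t+\epsilon_t$ is sub-Gaussian noise with bounded mean). Let $\sigma_\epsilon$ be the largest eigenvalue of $\Sigma_\epsilon$. The loop is $$z_{t+1}=z_t+v_t,\quad z_0=\mu_0,\qquad u_t=K(\hat x_t-z_t)+v_t,\qquad \hat x_{t+1}=\hat x_t+u_t+L(y_{t+1}-\hat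 x_t-u_t),$$ and $e_t:=[\hat x_t-x_t;\,x_t-z_t]$ satisfies $e_0\sim\mathcal{SG}(0,\sigma_0^2 I)$ with $\sigma_0>0$. Put $$A^e=\begin{bmatrix}I-L&0\\K&I+K\end{bmatrix},\quad B_1^e=\begin{bmatrix}-(I-L)\\I\end{bmatrix},\quad B_2^e=\begin{bmatrix}L\\0\end{bmatrix},\quad K_e=\begin{bmatrix}0&I\\K&K\end{bmatrix},$$ so that $e_{t+1}=A^ee_t+B_1^ew_t+B_2^e(m_{t+1}+\epsilon_{t+1})$ and $[x_t-z_t;u_t-v_t]=K_ee_t$. Assume $A^e$ is Schur stable. Define $$\Sigma_0=\sigma_0^2I,\quad \Sigma_{t+1}=A^e\Sigma_t{A^e}^\top+B_2^e\Sigma_\epsilon {B_2^e}^\top,\qquad \mathcal F_0=\{0\},\quad \mathcal F_{t+1}=A^e\mathcal F_t\oplus B_1^e\mathcal W\oplus B_2^e\mathcal M,$$ $$\mathcal E_t=\Big\{\xi\in\mathbb R^{2n}:\ \xi^\top(K_e\Sigma_tK_e^\top)^{-1}\xi\le 2n+2n\,\kappa^{-1}\big(\delta^{-1/n}\big)\Big\}\oplus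 K_e\mathcal F_t,$$ where $\delta\in(0,1)$ and $\kappa^{-1}$ is the inverse of $\kappa(a)=e^a/(1+a)$ on $[0,\infty)$. Let $\mathcal X,\mathcal U\subseteq\mathbb R^n$ be measurable, with $\mathcal U$ bounded, and let $S\ominus E=\{a: a+b\in S\ \forall b\in E\}$. Let $c(x,u)=\frac12x^\top Qx+\frac12u^\top Ru$ with $Q,R\succeq0$, and $c_f(x)=\frac12x^\top Px$, where $P$ solves the Lyapunov equation $P=(I+K)^\top P(I+K)+Q+K^\top RK$. The *MPC problem* at time $t$ is: minimize $c_f(\bar x_{H|t})+\sum_{i=0}^{H-1}c(\bar x_{i|t},u_{i|t})$ over $v_{0|t},\dots,v_{H-1|t}$ subject to, for $0\le i\le H-1$, $z_{i+1|t}=z_{i|t}+v_{i|t}$, $u_{i|t}=v_{i|t}+K(\bar x_{i|t}-z_{i|t})$, $\bar x_{i+1|t}=\bar x_{i|t}+u_{i|t}$, $[z_{i|t};v_{i|t}]\in(\mathcal X\times\mathcal U)\ominus\mathcal E_{t+i}$, and $z_{H|t}\in\mathcal Z_f$, $\bar x_{0|t}=\hat x_t$, $z_{0|t}=z_t$. Whenever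 it is feasible, the applied $v_t$ is the first element $v^*_{0|t}$ of an optimal solution (chosen so that $v_t$ is a random variable). **Theorem (Closed-loop properties).** Assume that for all $z\in\mathcal Z_f$ and $t\in\mathbb N$: $(I+K)z\in\mathcal Z_f$ and $[z;Kz]\in(\mathcal X\times\mathcal U)\ominus\mathcal E_t$. Assume the MPC problem is feasible at $t=0$. Then: 1. the MPC problem is feasible for all $t\in\mathbb N$; 2. $\Pr\{[x_t;u_t]\in\mathcal X\times\mathcal U\}\ge1-\delta$ for all $t\in\mathbb N$; 3. $\displaystyle\limsup_{T\to\infty}\frac1T\sum_{t=0}^{T-1}\mathbb E[c(x_t,u_t)]\le\kappa_w(r_w+r_m)+\kappa_\epsilon(\sigma_\epsilon),$ where $\kappa_w,\kappa_\epsilon:[0,\infty)\to[0,\infty)$ are of class $\mathcal K_\infty$ (continuous, strictly increasing, unbounded, zero at zero) and depend only on $n,H,K,L,Q,R,P,\mathcal U$; in particular not on the noise, the disturbances, their bounds, the initial data, $\delta$, $\mathcal X$ or $\mathcal Z_f$. -/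

import Mathlib

open MeasureTheory Filter
open scoped Matrix Pointwise NNReal ENNReal

noncomputable section

namespace BiasedSubGaussianMPC

/-! ### Vectors, comparison functions, elementary set and matrix notions -/

/-- Column vectors in `ℝⁿ`. -/
abbrev Vec (n : ℕ) := Fin n → ℝ

/-- Real `n × n` matrices. -/
abbrev Mat (n : ℕ) := Matrix (Fin n) (Fin n) ℝ

/-- Stacked vectors `[a; b]` with `a, b ∈ ℝⁿ`; the stacked vector is `Sum.elim a b`. -/
abbrev Vec2 (n : ℕ) := Fin n ⊕ Fin n → ℝ

/-- Real `2n × 2n` matrices, in `n × n` blocks. -/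
abbrev Mat2 (n : ℕ) := Matrix (Fin n ⊕ Fin n) (Fin n ⊕ Fin n) ℝ

/-- The class `𝒦_∞`: continuous, strictly increasing, unbounded, zero at zero. -/
structure IsKInfty (κ : ℝ≥0 → ℝ≥0) : Prop where
  continuous : Continuous κ
  strictMono : StrictMono κ
  unbounded : ∀ b : ℝ≥0, ∃ r : ℝ≥0, b < κ r
  zero : κ 0 = 0

/-- `‖x‖_V² = xᵀ V x`. -/
def sqNorm {ι : Type*} [Fintype ι] (V : Matrix ι ι ℝ) (x : ι → ℝ) : ℝ := x ⬝ᵥ V *ᵥ x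

/-- A real matrix is Schur stable if all its complex eigenvalues lie in the open unit disc. -/
def SchurStable {ι : Type*} [Fintype ι] [DecidableEq ι] (A : Matrix ι ι ℝ) : Prop :=
  ∀ a ∈ spectrum ℂ (A.map (algebraMap ℝ ℂ)), ‖a‖ < 1

/-- Largest (real) eigenvalue; used for symmetric positive definite matrices of positive size. -/
def maxEigenvalue {n : ℕ} (S : Mat n) : ℝ := sSup (spectrum ℝ S)

/-- The product `X × U`, as a set of stacked vectors. -/
def stackSet {n : ℕ} (X U : Set (Vec n)) : Set (Vec2 n) :=
  {ξ | (fun i => ξ (Sum.inl i)) ∈ X ∧ (fun i => ξ (Sum.inr i)) ∈ U}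

/-- Pontryagin difference `S ⊖ E`. -/
def pontryaginDiff {E : Type*} [Add E] (S T : Set E) : Set E := {a | ∀ b ∈ T, a + b ∈ S}

/-! ### Sub-Gaussian random vectors -/

/-- `ξ ∼ SG(0, S)`: zero-mean sub-Gaussian with variance proxy `S`. -/
def IsSubGaussian {Ω ι : Type*} [MeasurableSpace Ω] [Fintype ι] (ℙ : Measure Ω)
    (ξ : Ω → ι → ℝ) (S : Matrix ι ι ℝ) : Prop :=
  ∀ l : ι → ℝ, Integrable (fun ω => Real.exp (l ⬝ᵥ ξ ω)) ℙ ∧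
    ∫ ω, Real.exp (l ⬝ᵥ ξ ω) ∂ℙ ≤ Real.exp (sqNorm S l / 2)

/-- `ξ ∼ SG(0, S)` conditionally on the σ-algebra `𝓖`. -/
def IsCondSubGaussian {Ω ι : Type*} [Fintype ι]
    (𝓖 : MeasurableSpace Ω) [MeasurableSpace Ω] (ℙ : Measure Ω) (ξ : Ω → ι → ℝ) (S : Matrix ι ι ℝ) : Prop :=
  ∀ l : ι → ℝ, Integrable (fun ω => Real.exp (l ⬝ᵥ ξ ω)) ℙ ∧
    ℙ[fun ω => Real.exp (l ⬝ᵥ ξ ω) | 𝓖] ≤ᵐ[ℙ] fun _ => Real.exp (sqNorm S l / 2)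

/-! ### Problem data -/

/-- The offline design: feedback gain `K`, observer gain `L`, LQR weights `Q`, `R`, terminal
weight `P`, and the input constraint set `U`. -/
structure Design (n : ℕ) where
  K : Mat n
  L : Mat n
  Q : Mat n
  R : Mat n
  P : Mat n
  U : Set (Vec n)

/-- The remaining data: state constraint set `X`, terminal set `Zf`, disturbance set `W`,
measurement bias set `M`, measurement noise proxy `Seps`, initial mean `mu0`, initial
scale `sigma0`, admissible violation probability `delta`. -/
structure Scenario (n : ℕ) where
  X : Set (Vec n)
  Zf : Set (Vec n)
  W : Set (Vec n)
  M : Set (Vec n)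
  Seps : Mat n
  mu0 : Vec n
  sigma0 : ℝ
  delta : ℝ

variable {n : ℕ}

/-- Stage cost `c(x, u) = ½‖x‖_Q² + ½‖u‖_R²`. -/
def stageCost (D : Design n) (x u : Vec n) : ℝ := sqNorm D.Q x / 2 + sqNorm D.R u / 2

/-- Terminal cost `c_f(x) = ½‖x‖_P²`. -/
def terminalCost (D : Design n) (x : Vec n) : ℝ := sqNorm D.P x / 2

/-! ### Error propagation

With `ê = x̂ - x`, `ē = x - z` and `e = [ê; ē]`, the closed loop gives
`e⁺ = Ae e + B1 w + B2 (m⁺ + ε⁺)`, and `ξ = [x - z; u - v] = Ke e`. -/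

def Ae (D : Design n) : Mat2 n := Matrix.fromBlocks (1 - D.L) 0 D.K (1 + D.K)

def B1 (D : Design n) : Matrix (Fin n ⊕ Fin n) (Fin n) ℝ := Matrix.fromRows (-(1 - D.L)) 1

def B2 (D : Design n) : Matrix (Fin n ⊕ Fin n) (Fin n) ℝ := Matrix.fromRows D.L 0

def Ke (D : Design n) : Mat2 n := Matrix.fromBlocks 0 1 D.K D.K

/-- Variance proxy `Σ_t` of the stochastic part of the error. -/
def errProxy (D : Design n) (S : Scenario n) : ℕ → Mat2 n
  | 0 => S.sigma0 ^ 2 • 1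
  | t + 1 => Ae D * errProxy D S t * (Ae D)ᵀ + B2 D * S.Seps * (B2 D)ᵀ

/-- Reachable set of the bias part of the error. -/
def biasSet (D : Design n) (S : Scenario n) : ℕ → Set (Vec2 n)
  | 0 => {0}
  | t + 1 => (fun e => Ae D *ᵥ e) '' biasSet D S t + (fun w => B1 D *ᵥ w) '' S.W
      + (fun m => B2 D *ᵥ m) '' S.M

/-- `κ(x) = eˣ / (1 + x)`, an increasing bijection from `[0, ∞)` onto `[1, ∞)`. -/
def kap (x : ℝ) : ℝ := Real.exp x / (1 + x)

/-- The inverse of `κ : [0, ∞) → [1, ∞)`. -/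
def kapInv : ℝ → ℝ := Function.invFunOn kap (Set.Ici 0)

/-- Confidence ellipsoid for the stochastic part of `ξ_t`, with `n_c = 2n`. -/
def confSet (D : Design n) (S : Scenario n) (t : ℕ) : Set (Vec2 n) :=
  {ξ | sqNorm (Ke D * errProxy D S t * (Ke D)ᵀ)⁻¹ ξ ≤
    (2 * n : ℝ) + (2 * n : ℝ) * kapInv (S.delta ^ (-(2 : ℝ) / (2 * n : ℝ)))}

/-- Total error set `𝓔_t`: confidence ellipsoid plus the bias set of `ξ_t`. -/
def errSet (D : Design n) (S : Scenario n) (t : ℕ) : Set (Vec2 n) :=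
  confSet D S t + (fun e => Ke D *ᵥ e) '' biasSet D S t

/-- Tightened constraint set `(X × U) ⊖ 𝓔_t`. -/
def tightened (D : Design n) (S : Scenario n) (t : ℕ) : Set (Vec2 n) :=
  pontryaginDiff (stackSet S.X D.U) (errSet D S t)

/-- Terminal set assumption: positive invariance and tightened constraint satisfaction. -/
structure TerminalAssumption (D : Design n) (S : Scenario n) : Prop where
  invariant : ∀ z ∈ S.Zf, (1 + D.K) *ᵥ z ∈ S.Zf
  constraints : ∀ z ∈ S.Zf, ∀ t : ℕ, Sum.elim z (D.K *ᵥ z) ∈ tightened D S t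

/-! ### The MPC problem -/

/-- Decision variables and predicted trajectories over the horizon `H`. -/
structure Plan (n H : ℕ) where
  v : Fin H → Vec n
  u : Fin H → Vec n
  z : Fin (H + 1) → Vec n
  xbar : Fin (H + 1) → Vec n

/-- The constraints of the MPC problem at time `t`, with estimate `xh` and nominal state `z0`. -/
structure Plan.IsFeasible {H : ℕ} (p : Plan n H) (D : Design n) (S : Scenario n) (t : ℕ)
    (xh z0 : Vec n) : Prop where
  z_succ : ∀ i : Fin H, p.z i.succ = p.z i.castSucc + p.v i
  input : ∀ i : Fin H, p.u i = p.v i + D.K *ᵥ (p.xbar i.castSucc - p.z i.castSucc)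
  x_succ : ∀ i : Fin H, p.xbar i.succ = p.xbar i.castSucc + p.u i
  cons : ∀ i : Fin H, Sum.elim (p.z i.castSucc) (p.v i) ∈ tightened D S (t + i)
  terminal : p.z (Fin.last H) ∈ S.Zf
  x_init : p.xbar 0 = xh
  z_init : p.z 0 = z0

/-- The objective of the MPC problem. -/
def Plan.cost {H : ℕ} (p : Plan n H) (D : Design n) : ℝ :=
  terminalCost D (p.xbar (Fin.last H)) + ∑ i : Fin H, stageCost D (p.xbar i.castSucc) (p.u i)

/-- `p` is an optimal solution of the MPC problem. -/
def Plan.IsOptimal {H : ℕ} (p : Plan n H) (D : Design n) (S : Scenario n) (t : ℕ)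
    (xh z0 : Vec n) : Prop :=
  p.IsFeasible D S t xh z0 ∧
    ∀ q : Plan n H, q.IsFeasible D S t xh z0 → p.cost D ≤ q.cost D

/-- The MPC problem with horizon `H` is feasible. -/
def MPCFeasible (H : ℕ) (D : Design n) (S : Scenario n) (t : ℕ) (xh z0 : Vec n) : Prop :=
  ∃ p : Plan n H, p.IsFeasible D S t xh z0

/-! ### The closed loop -/

/-- All signals of the closed loop: state, measurement, input, disturbance, measurement bias,
measurement noise, state estimate, nominal state, nominal input. -/
structure Signals (Ω : Type*) (n : ℕ) where
  x : ℕ → Ω → Vec n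
  y : ℕ → Ω → Vec n
  u : ℕ → Ω → Vec n
  w : ℕ → Ω → Vec n
  m : ℕ → Ω → Vec n
  eps : ℕ → Ω → Vec n
  xh : ℕ → Ω → Vec n
  z : ℕ → Ω → Vec n
  v : ℕ → Ω → Vec n

/-- Assumptions on the uncertainty. The noise `ε_{t+1}` is sub-Gaussian conditionally on a history
`𝓕 t` containing the initial data and the noise up to time `t` (and possibly more, such as the
current state). The biases and disturbances are arbitrary in their sets, and may depend on
anything. The values `m_0`, `ε_0` do not enter the loop. -/
structure NoiseModel {Ω : Type*} [mΩ : MeasurableSpace Ω] (ℙ : Measure Ω)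
    (𝓕 : Filtration ℕ mΩ) (S : Scenario n) (s : Signals Ω n) : Prop where
  w_meas : ∀ t, Measurable (s.w t)
  m_meas : ∀ t, Measurable (s.m t)
  eps_meas : ∀ t, Measurable[𝓕 t] (s.eps t)
  x0_meas : Measurable[𝓕 0] (s.x 0)
  xh0_meas : Measurable[𝓕 0] (s.xh 0)
  w_mem : ∀ t ω, s.w t ω ∈ S.W
  m_mem : ∀ t ω, s.m t ω ∈ S.M
  eps_subGaussian : ∀ t, IsCondSubGaussian (𝓕 t) ℙ (s.eps (t + 1)) S.Seps
  init_subGaussian : IsSubGaussian ℙ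
    (fun ω => Sum.elim (s.xh 0 ω - s.x 0 ω) (s.x 0 ω - S.mu0)) (S.sigma0 ^ 2 • (1 : Mat2 n))

/-- The closed loop of system, observer and MPC. Whenever the MPC problem is feasible, the nominal
input is the first element of an optimal solution; otherwise it is unspecified. -/
structure IsClosedLoop {Ω : Type*} [MeasurableSpace Ω] (H : ℕ) [NeZero H]
    (D : Design n) (S : Scenario n) (s : Signals Ω n) : Prop where
  dynamics : ∀ t ω, s.x (t + 1) ω = s.x t ω + s.u t ω + s.w t ω
  measurement : ∀ t ω, s.y t ω = s.x t ω + s.m t ω + s.eps t ω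
  nominal_init : ∀ ω, s.z 0 ω = S.mu0
  nominal : ∀ t ω, s.z (t + 1) ω = s.z t ω + s.v t ω
  observer : ∀ t ω, s.xh (t + 1) ω =
    s.xh t ω + s.u t ω + D.L *ᵥ (s.y (t + 1) ω - s.xh t ω - s.u t ω)
  input : ∀ t ω, s.u t ω = D.K *ᵥ (s.xh t ω - s.z t ω) + s.v t ω
  v_meas : ∀ t, Measurable (s.v t)
  mpc : ∀ t ω, MPCFeasible H D S t (s.xh t ω) (s.z t ω) →
    ∃ p : Plan n H, p.IsOptimal D S t (s.xh t ω) (s.z t ω) ∧ s.v t ω = p.v 0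

end BiasedSubGaussianMPC

end

/-! The tightened constraints involve only the nominal pair `(z, v)`, whereas the innovation enters
only through the estimate. Shifting a feasible plan and appending one step of `v = K z` is therefore
feasible again, whatever the innovation was (`IsExtendedPlan.shift_feasible`). This gives recursive
feasibility.

For the chance constraints, the error splits linearly into a bias part, which lies in `biasSet` for
every outcome, and a part driven by the initial error and the noise. Conditioning step by step shows
that the latter is sub-Gaussian with proxy `errProxy`. Averaging its moment generating function over
a Gaussian direction and optimising Markov's inequality gives a tail for the Mahalanobis norm, which
the level in `confSet` makes equal to `δ`. Schur stability forces `K` and `L` to be invertible, so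
all proxies that are inverted are positive definite.

For the cost, the optimal value acts as a Lyapunov function (`exists_plan_descent`): it drops by the
stage cost, up to an error linear and quadratic in the innovation. Its constants must not depend on
`X` or `Zf`. The set `U` and the bias bound control all planned inputs; the appended input `K z_H`
is one of them, so invertibility of `K` bounds `z_H`, and the other nominal states follow backwards.

Telescoping gives a pathwise estimate in `q + q²`, with `q` the size of stochastic error,
disturbance and noise. With `θ = r + √σ`, the inequality `q ≤ θ + q²/θ` reduces this to second
moments, which are of order `σ` plus a summable transient from the initial error. The transient
disappears in the average, leaving a multiple of `θ + θ²`, which separates into a function of `r_w +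
r_m` and one of `σ`. -/

namespace BiasedSubGaussianMPC

/-! ### Norm bounds for matrices acting on vectors -/

section LinearAlgebra

variable {ι κ : Type*} [Fintype ι] [Fintype κ]

lemma exists_norm_mulVec_le (M : Matrix ι κ ℝ) : ∃ C : ℝ, 0 ≤ C ∧ ∀ x, ‖M *ᵥ x‖ ≤ C * ‖x‖ :=
  ⟨_, norm_nonneg _, (LinearMap.toContinuousLinearMap M.mulVecLin).le_opNorm⟩

lemma abs_dotProduct_le (x y : ι → ℝ) : |x ⬝ᵥ y| ≤ Fintype.card ι * (‖x‖ * ‖y‖) := by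
  refine (Finset.abs_sum_le_sum_abs _ _).trans ?_
  calc ∑ i, |x i * y i| ≤ ∑ _i : ι, ‖x‖ * ‖y‖ := by
        refine Finset.sum_le_sum fun i _ => ?_
        rw [abs_mul]
        exact mul_le_mul (norm_le_pi_norm x i) (norm_le_pi_norm y i) (abs_nonneg _) (norm_nonneg _)
    _ = _ := by simp

lemma norm_sq_le_sum_sq (x : ι → ℝ) : ‖x‖ ^ 2 ≤ ∑ i, x i ^ 2 := by
  have h0 : (0 : ℝ) ≤ ∑ i, x i ^ 2 := Finset.sum_nonneg fun i _ => sq_nonneg _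
  have : ‖x‖ ≤ √(∑ i, x i ^ 2) := by
    refine (pi_norm_le_iff_of_nonneg (Real.sqrt_nonneg _)).2 fun i => Real.le_sqrt_of_sq_le ?_
    rw [Real.norm_eq_abs, sq_abs]
    exact Finset.single_le_sum (f := fun i => x i ^ 2) (fun i _ => sq_nonneg _) (Finset.mem_univ i)
  calc ‖x‖ ^ 2 ≤ √(∑ i, x i ^ 2) ^ 2 := by gcongr
    _ = _ := Real.sq_sqrt h0

lemma dotProduct_self_le (x : ι → ℝ) : x ⬝ᵥ x ≤ Fintype.card ι * ‖x‖ ^ 2 := by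
  have := (le_abs_self _).trans (abs_dotProduct_le x x)
  rwa [← sq] at this

lemma exists_abs_bilin_le (V : Matrix ι ι ℝ) :
    ∃ C : ℝ, 0 ≤ C ∧ ∀ x y, |x ⬝ᵥ V *ᵥ y| ≤ C * (‖x‖ * ‖y‖) := by
  obtain ⟨C, hC, h⟩ := exists_norm_mulVec_le V
  refine ⟨Fintype.card ι * C, by positivity, fun x y => (abs_dotProduct_le _ _).trans ?_⟩
  rw [mul_assoc]
  refine mul_le_mul_of_nonneg_left ?_ (Nat.cast_nonneg _)
  calc ‖x‖ * ‖V *ᵥ y‖ ≤ ‖x‖ * (C * ‖y‖) := by gcongr; exact h y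
    _ = _ := by ring

lemma sqNorm_add (V : Matrix ι ι ℝ) (a h : ι → ℝ) :
    sqNorm V (a + h) = sqNorm V a + (a ⬝ᵥ V *ᵥ h + h ⬝ᵥ V *ᵥ a) + sqNorm V h := by
  simp only [sqNorm, Matrix.mulVec_add, dotProduct_add, add_dotProduct]; ring

lemma exists_sqNorm_le (V : Matrix ι ι ℝ) :
    ∃ C : ℝ, 0 ≤ C ∧ (∀ x, sqNorm V x ≤ C * ‖x‖ ^ 2) ∧
      ∀ a h, sqNorm V (a + h) ≤ sqNorm V a + C * (‖a‖ * ‖h‖ + ‖h‖ ^ 2) := by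
  obtain ⟨C, hC, hb⟩ := exists_abs_bilin_le V
  have hb' := fun x y => (le_abs_self _).trans (hb x y)
  have h2 : ∀ x, sqNorm V x ≤ C * ‖x‖ ^ 2 := fun x => by rw [sq]; exact hb' x x
  have hCs : ∀ x : ι → ℝ, 0 ≤ C * ‖x‖ ^ 2 := fun x => by positivity
  refine ⟨2 * C, by positivity, fun x => ?_, fun a h => ?_⟩
  · linarith [h2 x, hCs x]
  · rw [sqNorm_add]
    have := hb' a h
    have h3 := hb' h a
    rw [mul_comm ‖h‖] at h3
    linarith [h2 h, hCs h]

lemma sqNorm_zero (V : Matrix ι ι ℝ) : sqNorm V 0 = 0 := by simp [sqNorm]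

lemma sqNorm_add_matrix (V V' : Matrix ι ι ℝ) (x : ι → ℝ) :
    sqNorm (V + V') x = sqNorm V x + sqNorm V' x := by
  simp [sqNorm, Matrix.add_mulVec, dotProduct_add]

lemma sqNorm_conj (N : Matrix ι κ ℝ) (V : Matrix κ κ ℝ) (x : ι → ℝ) :
    sqNorm (N * V * Nᵀ) x = sqNorm V (Nᵀ *ᵥ x) := by
  rw [sqNorm, sqNorm, ← Matrix.mulVec_mulVec, ← Matrix.mulVec_mulVec, Matrix.dotProduct_mulVec,
    ← Matrix.mulVec_transpose]

lemma _root_.Matrix.PosSemidef.sqNorm_nonneg {V : Matrix ι ι ℝ} (hV : V.PosSemidef) (x : ι → ℝ) :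
    0 ≤ sqNorm V x := by
  simpa [sqNorm] using hV.dotProduct_mulVec_nonneg x

/-- The parallelogram bound for a positive semidefinite quadratic form. -/
lemma _root_.Matrix.PosSemidef.sqNorm_add_le {V : Matrix ι ι ℝ} (hV : V.PosSemidef)
    (a h : ι → ℝ) : sqNorm V (a + h) ≤ 2 * sqNorm V a + 2 * sqNorm V h := by
  have h1 := hV.sqNorm_nonneg (a - h)
  have h2 : sqNorm V (a - h) = sqNorm V a - (a ⬝ᵥ V *ᵥ h + h ⬝ᵥ V *ᵥ a) + sqNorm V h := by
    simp only [sqNorm, Matrix.mulVec_sub, dotProduct_sub, sub_dotProduct]; ring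
  rw [sqNorm_add]
  linarith

open scoped MatrixOrder in
lemma _root_.Matrix.PosSemidef.exists_transpose_mul_self {V : Matrix ι ι ℝ} (hV : V.PosSemidef) :
    ∃ B : Matrix ι ι ℝ, V = Bᵀ * B := by
  classical
  obtain ⟨B, hB⟩ := CStarAlgebra.nonneg_iff_eq_star_mul_self.mp hV.nonneg
  exact ⟨B, by rw [hB, Matrix.star_eq_conjTranspose, Matrix.conjTranspose_eq_transpose_of_trivial]⟩

/-- Cauchy–Schwarz on each row of a factor `B` with `V = Bᵀ B`; the trace of `V` is the sum of the
squared entries of `B`. -/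
lemma _root_.Matrix.PosSemidef.sqNorm_le_trace {V : Matrix ι ι ℝ} (hV : V.PosSemidef)
    (x : ι → ℝ) : sqNorm V x ≤ V.trace * (x ⬝ᵥ x) := by
  obtain ⟨B, rfl⟩ := hV.exists_transpose_mul_self
  have h1 : sqNorm (Bᵀ * B) x = ∑ i, (∑ j, B i j * x j) ^ 2 := by
    rw [sqNorm, ← Matrix.mulVec_mulVec, Matrix.dotProduct_mulVec, Matrix.vecMul_transpose]
    exact Finset.sum_congr rfl fun i _ => by rw [sq]; rfl
  have h2 : (Bᵀ * B).trace = ∑ i, ∑ j, B i j ^ 2 := by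
    simp only [Matrix.trace, Matrix.diag, Matrix.mul_apply, Matrix.transpose_apply, ← sq]
    exact Finset.sum_comm
  have h3 : x ⬝ᵥ x = ∑ j, x j ^ 2 := Finset.sum_congr rfl fun i _ => by rw [sq]
  rw [h1, h2, h3, Finset.sum_mul]
  exact Finset.sum_le_sum fun i _ => Finset.sum_mul_sq_le_sq_mul_sq _ _ _

end LinearAlgebra

/-! ### Quadratic forms and the largest eigenvalue. -/

section Eigenvalue

variable {n : ℕ}

lemma maxEigenvalue_bounds [NeZero n] {S : Mat n} (hS : S.PosDef) :
    0 < maxEigenvalue S ∧ S.trace ≤ n * maxEigenvalue S := by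
  have hspec := hS.1.spectrum_real_eq_range_eigenvalues
  have hle : ∀ i, hS.1.eigenvalues i ≤ maxEigenvalue S := fun i => by
    unfold maxEigenvalue
    rw [hspec]
    exact le_csSup (Set.finite_range _).bddAbove ⟨i, rfl⟩
  refine ⟨(hS.eigenvalues_pos 0).trans_le (hle 0), ?_⟩
  rw [hS.1.trace_eq_sum_eigenvalues]
  calc _ ≤ ∑ _i : Fin n, maxEigenvalue S := Finset.sum_le_sum fun i _ => hle i
    _ = _ := by simp

lemma sqNorm_le_maxEigenvalue [NeZero n] {S : Mat n} (hS : S.PosDef) (x : Vec n) :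
    sqNorm S x ≤ n ^ 2 * maxEigenvalue S * ‖x‖ ^ 2 := by
  obtain ⟨h0, h1⟩ := maxEigenvalue_bounds hS
  have h2 := dotProduct_self_le x
  rw [Fintype.card_fin] at h2
  calc sqNorm S x ≤ S.trace * (x ⬝ᵥ x) := hS.posSemidef.sqNorm_le_trace x
    _ ≤ (n * maxEigenvalue S) * (n * ‖x‖ ^ 2) :=
      mul_le_mul h1 h2 (by simpa using dotProduct_star_self_nonneg x) (by positivity)
    _ = _ := by ring

end Eigenvalue

/-! ### Powers of a Schur stable matrix -/

section Schur

-- This is the operator norm induced by the supremum norm, the norm that vectors `ι → ℝ` already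
-- carry.
attribute [local instance] Matrix.linftyOpNormedRing Matrix.linftyOpNormedAlgebra
  Matrix.linftyOpNormedAddCommGroup

variable {ι : Type*} [Fintype ι] [DecidableEq ι]

lemma norm_map_ofReal (A : Matrix ι ι ℝ) : ‖A.map (algebraMap ℝ ℂ)‖ = ‖A‖ := by
  simp [Matrix.linfty_opNorm_def]

lemma norm_transpose_le [Nonempty ι] (A : Matrix ι ι ℝ) : ‖Aᵀ‖ ≤ Fintype.card ι * ‖A‖ := by
  have hrow : ∀ i, ∑ j, ‖A i j‖₊ ≤ ‖A‖₊ := fun i => by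
    rw [Matrix.linfty_opNNNorm_def]
    exact Finset.le_sup (f := fun i => ∑ j, ‖A i j‖₊) (Finset.mem_univ i)
  have : ‖Aᵀ‖₊ ≤ Fintype.card ι * ‖A‖₊ := by
    rw [Matrix.linfty_opNNNorm_def]
    refine Finset.sup_le fun i _ => ?_
    calc ∑ j, ‖Aᵀ i j‖₊ ≤ ∑ _j : ι, ‖A‖₊ := Finset.sum_le_sum fun j _ =>
          (Finset.single_le_sum (f := fun k => ‖A j k‖₊) (fun _ _ => zero_le)
            (Finset.mem_univ i)).trans (hrow j)
      _ = _ := by simp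
  exact_mod_cast this

/-- Gelfand's formula over `ℂ`: the roots `‖a ^ j‖ ^ (1 / j)` tend to a spectral radius below one,
so the powers are eventually dominated by a geometric sequence. -/
lemma SchurStable.summable_norm_pow [Nonempty ι] {A : Matrix ι ι ℝ} (hA : SchurStable A) :
    Summable fun j : ℕ => ‖A ^ j‖ := by
  set a := A.map (algebraMap ℝ ℂ) with ha
  have hρ : spectralRadius ℂ a < 1 := by
    have := spectrum.spectralRadius_lt_of_forall_lt a (r := 1) fun z hz => by
      have := hA z hz
      exact_mod_cast this
    simpa using this
  obtain ⟨r, hr1, hr2⟩ := ENNReal.lt_iff_exists_nnreal_btwn.1 hρ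
  have hr2' : r < 1 := by exact_mod_cast hr2
  have hev := (spectrum.pow_nnnorm_pow_one_div_tendsto_nhds_spectralRadius a).eventually_lt_const hr1
  refine summable_of_isBigO_nat (summable_geometric_of_lt_one r.2 hr2') ?_
  refine Asymptotics.IsBigO.of_bound 1 ?_
  filter_upwards [hev, eventually_gt_atTop 0] with j hj hj0
  have hpow : (‖a ^ j‖₊ : ℝ≥0∞) ≤ (r : ℝ≥0∞) ^ j := by
    have h1 := ENNReal.rpow_le_rpow hj.le (Nat.cast_nonneg j : (0 : ℝ) ≤ j)
    rwa [← ENNReal.rpow_mul, one_div, inv_mul_cancel₀ (by positivity), ENNReal.rpow_one,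
      ENNReal.rpow_natCast] at h1
  have h2 : ‖a ^ j‖ ≤ (r : ℝ) ^ j := by exact_mod_cast hpow
  have h3 : (A ^ j).map (algebraMap ℝ ℂ) = a ^ j := Matrix.map_pow A (algebraMap ℝ ℂ) j
  rw [norm_norm, ← norm_map_ofReal, h3, one_mul]
  exact h2.trans (le_abs_self _)

/-- One sequence serves both `A` (bias sets, predictions) and `Aᵀ` (variance proxies, seen through
test vectors). The factor `Fintype.card ι` is the price of transposing in this norm. -/
lemma SchurStable.exists_summable_bound [Nonempty ι] {A : Matrix ι ι ℝ} (hA : SchurStable A) :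
    ∃ α : ℕ → ℝ, Summable α ∧ (∀ j, 0 ≤ α j) ∧ (∀ j x, ‖(A ^ j) *ᵥ x‖ ≤ α j * ‖x‖) ∧
      ∀ j x, ‖(Aᵀ ^ j) *ᵥ x‖ ≤ α j * ‖x‖ := by
  have hc : (1 : ℝ) ≤ Fintype.card ι := by exact_mod_cast Fintype.card_pos
  refine ⟨fun j => Fintype.card ι * ‖A ^ j‖, hA.summable_norm_pow.mul_left _,
    fun j => by positivity, fun j x => ?_, fun j x => ?_⟩
  · refine (Matrix.linfty_opNorm_mulVec _ _).trans ?_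
    refine mul_le_mul_of_nonneg_right ?_ (norm_nonneg _)
    exact le_mul_of_one_le_left (norm_nonneg _) hc
  · refine (Matrix.linfty_opNorm_mulVec _ _).trans ?_
    refine mul_le_mul_of_nonneg_right ?_ (norm_nonneg _)
    rw [← Matrix.transpose_pow]
    exact norm_transpose_le _

end Schur

/-! ### Consequences of Schur stability of the error dynamics for the design -/

section Design

variable {n : ℕ} (D : Design n)

lemma norm_elim_zero_left (v : Vec n) : ‖(Sum.elim 0 v : Vec2 n)‖ = ‖v‖ := by
  apply le_antisymm
  · refine (pi_norm_le_iff_of_nonneg (norm_nonneg _)).2 fun i => ?_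
    rcases i with i | i
    · simp
    · exact norm_le_pi_norm v i
  · refine (pi_norm_le_iff_of_nonneg (norm_nonneg _)).2 fun i => ?_
    exact norm_le_pi_norm (Sum.elim 0 v : Vec2 n) (Sum.inr i)

lemma norm_inl_le (e : Vec2 n) : ‖fun i => e (Sum.inl i)‖ ≤ ‖e‖ :=
  (pi_norm_le_iff_of_nonneg (norm_nonneg _)).2 fun i => norm_le_pi_norm e (Sum.inl i)

lemma norm_inr_le (e : Vec2 n) : ‖fun i => e (Sum.inr i)‖ ≤ ‖e‖ :=
  (pi_norm_le_iff_of_nonneg (norm_nonneg _)).2 fun i => norm_le_pi_norm e (Sum.inr i)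

/-- `Ae` is block lower triangular, so it preserves vectors with zero upper block and acts there as
`1 + K`. Decay of the powers of `Ae` thus passes to `1 + K`. -/
lemma Ae_pow_mulVec_elim_zero (j : ℕ) (v : Vec n) :
    (Ae D ^ j) *ᵥ Sum.elim (0 : Vec n) v = Sum.elim (0 : Vec n) (((1 + D.K) ^ j) *ᵥ v) := by
  induction j generalizing v with
  | zero => simp
  | succ j ih =>
    rw [pow_succ, ← Matrix.mulVec_mulVec, Ae, Matrix.fromBlocks_mulVec]
    simp only [Sum.elim_comp_inl, Sum.elim_comp_inr, Matrix.mulVec_zero, Matrix.zero_mulVec,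
      add_zero, zero_add]
    rw [← Ae, ih, Matrix.mulVec_mulVec, ← pow_succ]

variable {D}

lemma norm_pow_one_add_K_mulVec_le {α : ℕ → ℝ} (hα : ∀ j x, ‖(Ae D ^ j) *ᵥ x‖ ≤ α j * ‖x‖)
    (j : ℕ) (v : Vec n) : ‖((1 + D.K) ^ j) *ᵥ v‖ ≤ α j * ‖v‖ := by
  have := hα j (Sum.elim 0 v)
  rwa [Ae_pow_mulVec_elim_zero, norm_elim_zero_left, norm_elim_zero_left] at this

/-- A kernel vector of `K` would be fixed by `1 + K`, against the decay of its powers. -/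
lemma isUnit_det_K {α : ℕ → ℝ} (hs : Summable α)
    (hα : ∀ j x, ‖(Ae D ^ j) *ᵥ x‖ ≤ α j * ‖x‖) : IsUnit D.K.det := by
  rw [isUnit_iff_ne_zero]
  intro h0
  obtain ⟨v, hv, hKv⟩ := Matrix.exists_mulVec_eq_zero_iff.2 h0
  have hfix : ∀ j : ℕ, ((1 + D.K) ^ j) *ᵥ v = v := fun j => by
    induction j with
    | zero => simp
    | succ j ih =>
      rw [pow_succ, ← Matrix.mulVec_mulVec, Matrix.add_mulVec, hKv, Matrix.one_mulVec, add_zero, ih]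
  have hle : ∀ j, ‖v‖ ≤ α j * ‖v‖ := fun j => by
    simpa [hfix j] using norm_pow_one_add_K_mulVec_le hα j v
  have hlim := (hs.tendsto_atTop_zero.mul_const ‖v‖)
  rw [zero_mul] at hlim
  have := ge_of_tendsto' hlim hle
  exact hv (norm_le_zero_iff.1 this)

lemma exists_norm_le_norm_K {α : ℕ → ℝ} (hs : Summable α)
    (hα : ∀ j x, ‖(Ae D ^ j) *ᵥ x‖ ≤ α j * ‖x‖) :
    ∃ C : ℝ, 0 ≤ C ∧ ∀ x, ‖x‖ ≤ C * ‖D.K *ᵥ x‖ := by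
  obtain ⟨C, hC, h⟩ := exists_norm_mulVec_le D.K⁻¹
  refine ⟨C, hC, fun x => ?_⟩
  have := h (D.K *ᵥ x)
  rwa [Matrix.mulVec_mulVec, Matrix.nonsing_inv_mul _ (isUnit_det_K hs hα), Matrix.one_mulVec] at this

lemma sqNorm_lyapunov (hP : (1 + D.K)ᵀ * D.P * (1 + D.K) + D.Q + D.Kᵀ * D.R * D.K = D.P)
    (x : Vec n) : sqNorm D.P x =
      sqNorm D.P ((1 + D.K) *ᵥ x) + sqNorm D.Q x + sqNorm D.R (D.K *ᵥ x) := by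
  have h1 := sqNorm_conj (1 + D.K)ᵀ D.P x
  have h2 := sqNorm_conj D.Kᵀ D.R x
  rw [Matrix.transpose_transpose] at h1 h2
  rw [← h1, ← h2, ← sqNorm_add_matrix, ← sqNorm_add_matrix, hP]

/-- Along the orbit of `1 + K` the Lyapunov equation makes the form nonincreasing, and it tends to
zero there; hence its initial value is nonnegative. Definiteness of `P` is derived this way rather
than assumed. -/
lemma sqNorm_P_nonneg {α : ℕ → ℝ} (hs : Summable α) (hα0 : ∀ j, 0 ≤ α j)
    (hα : ∀ j x, ‖(Ae D ^ j) *ᵥ x‖ ≤ α j * ‖x‖) (hQ : D.Q.PosSemidef) (hR : D.R.PosSemidef)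
    (hP : (1 + D.K)ᵀ * D.P * (1 + D.K) + D.Q + D.Kᵀ * D.R * D.K = D.P) (x : Vec n) :
    0 ≤ sqNorm D.P x := by
  obtain ⟨C, hC, hb⟩ := exists_abs_bilin_le D.P
  have hmono : ∀ j : ℕ, sqNorm D.P (((1 + D.K) ^ j) *ᵥ x) ≤ sqNorm D.P x := fun j => by
    induction j with
    | zero => simp
    | succ j ih =>
      have := sqNorm_lyapunov hP (((1 + D.K) ^ j) *ᵥ x)
      rw [Matrix.mulVec_mulVec, ← pow_succ'] at this
      linarith [hQ.sqNorm_nonneg (((1 + D.K) ^ j) *ᵥ x),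
        hR.sqNorm_nonneg (D.K *ᵥ ((1 + D.K) ^ j) *ᵥ x)]
  have hlow : ∀ j, -(C * ((α j * ‖x‖) * (α j * ‖x‖))) ≤ sqNorm D.P x := fun j => by
    refine le_trans ?_ (hmono j)
    refine le_trans ?_ (neg_le_of_abs_le (hb _ _))
    have h := norm_pow_one_add_K_mulVec_le hα j x
    have := hα0 j
    gcongr
  have h0 := hs.tendsto_atTop_zero.mul_const ‖x‖
  rw [zero_mul] at h0
  have hlim := ((h0.mul h0).const_mul C).neg
  simp only [mul_zero, neg_zero] at hlim
  exact le_of_tendsto' hlim hlow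

end Design

/-! ### Sub-Gaussian vectors through Lebesgue integrals -/

section SubGaussian

variable {Ω ι κ : Type*} [Fintype ι] [Fintype κ]

/-- The moment generating function bound of a sub-Gaussian vector, as a Lebesgue integral. -/
def HasSubGaussianBound [MeasurableSpace Ω] (ℙ : Measure Ω) (ξ : Ω → ι → ℝ)
    (S : Matrix ι ι ℝ) : Prop :=
  ∀ l : ι → ℝ, ∫⁻ ω, ENNReal.ofReal (Real.exp (l ⬝ᵥ ξ ω)) ∂ℙ ≤
    ENNReal.ofReal (Real.exp (sqNorm S l / 2))

lemma IsSubGaussian.hasSubGaussianBound [MeasurableSpace Ω] {ℙ : Measure Ω} {ξ : Ω → ι → ℝ}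
    {S : Matrix ι ι ℝ} (h : IsSubGaussian ℙ ξ S) : HasSubGaussianBound ℙ ξ S := fun l => by
  rw [← ofReal_integral_eq_lintegral_ofReal (h l).1
    (Eventually.of_forall fun ω => (Real.exp_pos _).le)]
  exact ENNReal.ofReal_le_ofReal (h l).2

/-- Restricted to `𝓖`, the measure with density `Y` is dominated by `c` times `ℙ`, and the
domination carries over to integrals of `𝓖`-measurable functions. Integrability of the product need
not be known in advance. -/
lemma lintegral_mul_le_of_condExp_le {𝓖 mΩ : MeasurableSpace Ω} (h𝓖 : 𝓖 ≤ mΩ) {ℙ : Measure Ω}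
    [IsProbabilityMeasure ℙ] {Y : Ω → ℝ} (hYm : Measurable Y) (hY0 : ∀ ω, 0 ≤ Y ω)
    (hY : Integrable Y ℙ) {c : ℝ} (hc : ℙ[Y | 𝓖] ≤ᵐ[ℙ] fun _ => c)
    {f : Ω → ℝ≥0∞} (hf : Measurable[𝓖] f) :
    ∫⁻ ω, ENNReal.ofReal (Y ω) * f ω ∂ℙ ≤ ENNReal.ofReal c * ∫⁻ ω, f ω ∂ℙ := by
  have hYm' : Measurable fun ω => ENNReal.ofReal (Y ω) := hYm.ennreal_ofReal
  have hle : (ℙ.withDensity fun ω => ENNReal.ofReal (Y ω)).trim h𝓖 ≤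
      ENNReal.ofReal c • ℙ.trim h𝓖 := by
    refine Measure.le_iff.2 fun A hA => ?_
    rw [trim_measurableSet_eq h𝓖 hA, withDensity_apply _ (h𝓖 A hA), Measure.smul_apply,
      trim_measurableSet_eq h𝓖 hA, smul_eq_mul,
      ← ofReal_integral_eq_lintegral_ofReal hY.restrict (Eventually.of_forall hY0),
      ← setIntegral_condExp h𝓖 hY hA]
    have h1 : ∫ ω in A, (ℙ[Y | 𝓖]) ω ∂ℙ ≤ ∫ _ω in A, c ∂ℙ :=
      integral_mono_ae integrable_condExp.restrict (integrable_const c) (ae_restrict_of_ae hc)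
    refine (ENNReal.ofReal_le_ofReal h1).trans (le_of_eq ?_)
    rw [setIntegral_const, smul_eq_mul, mul_comm, ENNReal.ofReal_mul' measureReal_nonneg,
      ofReal_measureReal]
  calc ∫⁻ ω, ENNReal.ofReal (Y ω) * f ω ∂ℙ
      = ∫⁻ ω, f ω ∂(ℙ.withDensity fun ω => ENNReal.ofReal (Y ω)) :=
        (lintegral_withDensity_eq_lintegral_mul _ hYm' (hf.mono h𝓖 le_rfl)).symm
    _ = ∫⁻ ω, f ω ∂(ℙ.withDensity fun ω => ENNReal.ofReal (Y ω)).trim h𝓖 :=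
        (lintegral_trim h𝓖 hf).symm
    _ ≤ ∫⁻ ω, f ω ∂(ENNReal.ofReal c • ℙ.trim h𝓖) := lintegral_mono' hle le_rfl
    _ = _ := by rw [lintegral_smul_measure, lintegral_trim h𝓖 hf, smul_eq_mul]

lemma IsCondSubGaussian.hasSubGaussianBound {𝓖 mΩ : MeasurableSpace Ω} (h𝓖 : 𝓖 ≤ mΩ)
    {ℙ : Measure Ω} [IsProbabilityMeasure ℙ] {ξ : Ω → ι → ℝ} (hξ : Measurable ξ)
    {S : Matrix ι ι ℝ} (h : IsCondSubGaussian 𝓖 ℙ ξ S) : HasSubGaussianBound ℙ ξ S := fun l => by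
  have hm : Measurable fun ω => Real.exp (l ⬝ᵥ ξ ω) := by unfold dotProduct; fun_prop
  simpa using lintegral_mul_le_of_condExp_le h𝓖 hm (fun ω => (Real.exp_pos _).le) (h l).1 (h l).2
    (f := fun _ => 1) measurable_const

lemma HasSubGaussianBound.mulVec [MeasurableSpace Ω] {ℙ : Measure Ω} {ξ : Ω → ι → ℝ}
    {S : Matrix ι ι ℝ} (h : HasSubGaussianBound ℙ ξ S) (M : Matrix κ ι ℝ) :
    HasSubGaussianBound ℙ (fun ω => M *ᵥ ξ ω) (M * S * Mᵀ) := fun l => by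
  rw [sqNorm_conj]
  refine le_trans (le_of_eq ?_) (h (Mᵀ *ᵥ l))
  refine lintegral_congr fun ω => ?_
  rw [Matrix.dotProduct_mulVec, ← Matrix.mulVec_transpose]

/-- The exponential of the sum factors; the factor with `ζ` is bounded conditionally on `𝓖`, the
other one is `𝓖`-measurable. This is one step of the variance recursion. -/
lemma HasSubGaussianBound.add_condSubGaussian {𝓖 mΩ : MeasurableSpace Ω} (h𝓖 : 𝓖 ≤ mΩ)
    {ℙ : Measure Ω} [IsProbabilityMeasure ℙ] {ξ : Ω → ι → ℝ} {ζ : Ω → κ → ℝ}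
    (hξm : Measurable[𝓖] ξ) (hζm : Measurable ζ) {S : Matrix ι ι ℝ} {V : Matrix κ κ ℝ}
    (hξ : HasSubGaussianBound ℙ ξ S) (hζ : IsCondSubGaussian 𝓖 ℙ ζ V) (A : Matrix ι ι ℝ)
    (B : Matrix ι κ ℝ) :
    HasSubGaussianBound ℙ (fun ω => A *ᵥ ξ ω + B *ᵥ ζ ω) (A * S * Aᵀ + B * V * Bᵀ) := fun l => by
  have hm : Measurable fun ω => Real.exp ((Bᵀ *ᵥ l) ⬝ᵥ ζ ω) := by unfold dotProduct; fun_prop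
  have hf : Measurable[𝓖] fun ω => ENNReal.ofReal (Real.exp ((Aᵀ *ᵥ l) ⬝ᵥ ξ ω)) := by
    unfold dotProduct
    fun_prop
  have key := lintegral_mul_le_of_condExp_le h𝓖 hm (fun ω => (Real.exp_pos _).le)
    (hζ (Bᵀ *ᵥ l)).1 (hζ (Bᵀ *ᵥ l)).2 hf
  calc ∫⁻ ω, ENNReal.ofReal (Real.exp (l ⬝ᵥ (A *ᵥ ξ ω + B *ᵥ ζ ω))) ∂ℙ
      = ∫⁻ ω, ENNReal.ofReal (Real.exp ((Bᵀ *ᵥ l) ⬝ᵥ ζ ω)) *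
          ENNReal.ofReal (Real.exp ((Aᵀ *ᵥ l) ⬝ᵥ ξ ω)) ∂ℙ := by
        refine lintegral_congr fun ω => ?_
        rw [← ENNReal.ofReal_mul (Real.exp_pos _).le, ← Real.exp_add, dotProduct_add,
          Matrix.dotProduct_mulVec, Matrix.dotProduct_mulVec, ← Matrix.mulVec_transpose,
          ← Matrix.mulVec_transpose, add_comm]
    _ ≤ _ := key
    _ ≤ ENNReal.ofReal (Real.exp (sqNorm V (Bᵀ *ᵥ l) / 2)) *
          ENNReal.ofReal (Real.exp (sqNorm S (Aᵀ *ᵥ l) / 2)) := by gcongr; exact hξ _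
    _ = _ := by
        rw [← ENNReal.ofReal_mul (Real.exp_pos _).le, ← Real.exp_add, sqNorm_add_matrix,
          sqNorm_conj, sqNorm_conj, add_div, add_comm]

/-! ### Second moments -/

lemma sqNorm_smul (V : Matrix ι ι ℝ) (c : ℝ) (x : ι → ℝ) :
    sqNorm V (c • x) = c ^ 2 * sqNorm V x := by
  simp only [sqNorm, Matrix.mulVec_smul, dotProduct_smul, smul_dotProduct, smul_eq_mul]; ring

/-- Half-angle formula `cosh x = 1 + 2 sinh² (x / 2)` together with `|y| ≤ sinh |y|`. -/
lemma two_add_sq_le_exp_add_exp_neg (x : ℝ) : 2 + x ^ 2 ≤ Real.exp x + Real.exp (-x) := by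
  have h1 : (x / 2) ^ 2 ≤ Real.sinh (x / 2) ^ 2 := by
    rw [sq_le_sq, Real.abs_sinh]
    exact Real.self_le_sinh_iff.2 (abs_nonneg _)
  have h2 := Real.cosh_two_mul (x / 2)
  rw [Real.cosh_sq, mul_div_cancel₀ x two_ne_zero, Real.cosh_eq] at h2
  linarith

lemma HasSubGaussianBound.lintegral_dotProduct_sq_le [MeasurableSpace Ω] {ℙ : Measure Ω}
    [IsProbabilityMeasure ℙ] {ξ : Ω → ι → ℝ} {S : Matrix ι ι ℝ} (h : HasSubGaussianBound ℙ ξ S)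
    (hξ : Measurable ξ) {l : ι → ℝ} {τ : ℝ} (hτ : 0 < τ) (hl : sqNorm S l ≤ τ) :
    ∫⁻ ω, ENNReal.ofReal ((l ⬝ᵥ ξ ω) ^ 2) ∂ℙ ≤ ENNReal.ofReal (2 * τ) := by
  have hm : Measurable fun ω => l ⬝ᵥ ξ ω := by unfold dotProduct; fun_prop
  -- At this scale the exponent in the moment bound is at most `1 / 2 < log 2`, so the exponentials
  -- at `c` and `-c` each have mean at most `2`.
  set c : ℝ := (√τ)⁻¹ with hc
  have hc2 : c ^ 2 = τ⁻¹ := by rw [hc, inv_pow, Real.sq_sqrt hτ.le]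
  have hexp : ∀ c' : ℝ, c' ^ 2 = τ⁻¹ →
      ∫⁻ ω, ENNReal.ofReal (Real.exp (c' * (l ⬝ᵥ ξ ω))) ∂ℙ ≤ ENNReal.ofReal 2 := fun c' hc' => by
    have h1 := h (c' • l)
    simp only [smul_dotProduct, smul_eq_mul] at h1
    refine h1.trans (ENNReal.ofReal_le_ofReal ?_)
    rw [sqNorm_smul, hc']
    have h2 : τ⁻¹ * sqNorm S l / 2 ≤ Real.log 2 := by
      have : τ⁻¹ * sqNorm S l ≤ 1 := by
        rw [inv_mul_le_iff₀ hτ, mul_one]; exact hl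
      linarith [Real.log_two_gt_d9]
    calc _ ≤ Real.exp (Real.log 2) := Real.exp_le_exp.2 h2
      _ = 2 := Real.exp_log two_pos
  have hsum : ENNReal.ofReal 2 + ∫⁻ ω, ENNReal.ofReal (τ⁻¹ * (l ⬝ᵥ ξ ω) ^ 2) ∂ℙ ≤
      ENNReal.ofReal 2 + ENNReal.ofReal 2 := by
    calc _ = ∫⁻ ω, ENNReal.ofReal 2 + ENNReal.ofReal (τ⁻¹ * (l ⬝ᵥ ξ ω) ^ 2) ∂ℙ := by
          rw [lintegral_add_left measurable_const, lintegral_const, measure_univ, mul_one]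
      _ ≤ ∫⁻ ω, ENNReal.ofReal (Real.exp (c * (l ⬝ᵥ ξ ω))) +
            ENNReal.ofReal (Real.exp (-c * (l ⬝ᵥ ξ ω))) ∂ℙ := by
          refine lintegral_mono fun ω => ?_
          rw [← ENNReal.ofReal_add two_pos.le (by positivity),
            ← ENNReal.ofReal_add (Real.exp_pos _).le (Real.exp_pos _).le]
          refine ENNReal.ofReal_le_ofReal ?_
          have := two_add_sq_le_exp_add_exp_neg (c * (l ⬝ᵥ ξ ω))
          rwa [mul_pow, hc2, ← neg_mul] at this
      _ = _ := lintegral_add_left (by fun_prop) _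
      _ ≤ _ := add_le_add (hexp c hc2) (hexp (-c) (by rw [neg_sq, hc2]))
  have hle := ENNReal.le_of_add_le_add_left ENNReal.ofReal_ne_top hsum
  calc ∫⁻ ω, ENNReal.ofReal ((l ⬝ᵥ ξ ω) ^ 2) ∂ℙ
      = ∫⁻ ω, ENNReal.ofReal τ * ENNReal.ofReal (τ⁻¹ * (l ⬝ᵥ ξ ω) ^ 2) ∂ℙ := by
        refine lintegral_congr fun ω => ?_
        rw [← ENNReal.ofReal_mul hτ.le, mul_inv_cancel_left₀ hτ.ne']
    _ = ENNReal.ofReal τ * ∫⁻ ω, ENNReal.ofReal (τ⁻¹ * (l ⬝ᵥ ξ ω) ^ 2) ∂ℙ :=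
        lintegral_const_mul _ (by fun_prop)
    _ ≤ ENNReal.ofReal τ * ENNReal.ofReal 2 := by gcongr
    _ = _ := by rw [← ENNReal.ofReal_mul hτ.le, mul_comm]

lemma HasSubGaussianBound.lintegral_norm_sq_le [MeasurableSpace Ω] {ℙ : Measure Ω}
    [IsProbabilityMeasure ℙ] {ξ : Ω → ι → ℝ} {S : Matrix ι ι ℝ} (h : HasSubGaussianBound ℙ ξ S)
    (hξ : Measurable ξ) {τ : ℝ} (hτ : 0 < τ) (hS : ∀ l, ‖l‖ ≤ 1 → sqNorm S l ≤ τ) :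
    ∫⁻ ω, ENNReal.ofReal (‖ξ ω‖ ^ 2) ∂ℙ ≤ ENNReal.ofReal (2 * Fintype.card ι * τ) := by
  classical
  calc ∫⁻ ω, ENNReal.ofReal (‖ξ ω‖ ^ 2) ∂ℙ
      ≤ ∫⁻ ω, ∑ i, ENNReal.ofReal ((ξ ω i) ^ 2) ∂ℙ := lintegral_mono fun ω => by
        rw [← ENNReal.ofReal_sum_of_nonneg fun i _ => sq_nonneg _]
        exact ENNReal.ofReal_le_ofReal (norm_sq_le_sum_sq _)
    _ = ∑ i, ∫⁻ ω, ENNReal.ofReal ((ξ ω i) ^ 2) ∂ℙ :=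
        lintegral_finsetSum _ fun i _ => by fun_prop
    _ ≤ ∑ _i : ι, ENNReal.ofReal (2 * τ) := Finset.sum_le_sum fun i _ => by
        have h1 : ‖(Pi.single i (1 : ℝ) : ι → ℝ)‖ ≤ 1 := by
          refine (pi_norm_le_iff_of_nonneg zero_le_one).2 fun j => ?_
          by_cases hj : j = i
          · subst hj; simp
          · simp [Pi.single_eq_of_ne hj]
        simpa using h.lintegral_dotProduct_sq_le hξ hτ (hS _ h1)
    _ = _ := by
        rw [Finset.sum_const, Finset.card_univ, nsmul_eq_mul, ← ENNReal.ofReal_natCast,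
          ← ENNReal.ofReal_mul (Nat.cast_nonneg _)]
        congr 1; ring

/-! ### Confidence ellipsoids -/

open ProbabilityTheory (gaussianReal gaussianPDFReal gaussianPDF_def gaussianPDFReal_nonneg
  gaussianReal_of_var_ne_zero integral_gaussianReal_eq_integral_smul mgf mgf_gaussianReal
  integrable_exp_mul_gaussianReal)

/-- The weight turns the standard density into an unnormalised Gaussian of variance `1 / (1 - s)`.
-/
lemma integral_exp_sq_gaussianReal {s : ℝ} (hs : s < 1) :
    Integrable (fun g : ℝ => Real.exp (s / 2 * g ^ 2)) (gaussianReal 0 1) ∧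
      ∫ g, Real.exp (s / 2 * g ^ 2) ∂(gaussianReal 0 1) = (√(1 - s))⁻¹ := by
  have hpdf : ∀ g : ℝ, gaussianPDFReal 0 1 g * Real.exp (s / 2 * g ^ 2) =
      (√(2 * Real.pi))⁻¹ * Real.exp (-((1 - s) / 2) * g ^ 2) := fun g => by
    rw [gaussianPDFReal, mul_assoc, ← Real.exp_add]
    congr 2
    · simp
    · simp; ring
  have hb : 0 < (1 - s) / 2 := by linarith
  constructor
  · rw [gaussianReal_of_var_ne_zero _ one_ne_zero, gaussianPDF_def,
      integrable_withDensity_iff (by fun_prop) (Eventually.of_forall fun _ => ENNReal.ofReal_lt_top)]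
    refine ((integrable_exp_neg_mul_sq hb).const_mul (√(2 * Real.pi))⁻¹).congr
      (Eventually.of_forall fun g => ?_)
    simp only
    rw [ENNReal.toReal_ofReal (gaussianPDFReal_nonneg _ _ _), mul_comm (Real.exp _), hpdf]
  · rw [integral_gaussianReal_eq_integral_smul one_ne_zero]
    simp only [smul_eq_mul, hpdf]
    rw [integral_const_mul, integral_gaussian, ← Real.sqrt_inv, ← Real.sqrt_inv,
      ← Real.sqrt_mul (by positivity)]
    congr 1
    have : 1 - s ≠ 0 := by linarith
    field_simp

lemma lintegral_prod_pi_gaussian {f : ι → ℝ → ℝ} (hf0 : ∀ i g, 0 ≤ f i g)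
    (hf : ∀ i, Integrable (f i) (gaussianReal 0 1)) :
    ∫⁻ g : ι → ℝ, ENNReal.ofReal (∏ i, f i (g i)) ∂(Measure.pi fun _ => gaussianReal 0 1) =
      ENNReal.ofReal (∏ i, ∫ g, f i g ∂(gaussianReal 0 1)) := by
  rw [← ofReal_integral_eq_lintegral_ofReal (Integrable.fintype_prod hf)
    (Eventually.of_forall fun g => Finset.prod_nonneg fun i _ => hf0 i _),
    integral_fintype_prod_eq_prod]

/-- Averaging the moment generating function against a standard Gaussian vector. -/
lemma HasSubGaussianBound.lintegral_exp_sq_le [DecidableEq ι] [MeasurableSpace Ω] {ℙ : Measure Ω}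
    [IsProbabilityMeasure ℙ] {ξ : Ω → ι → ℝ} (h : HasSubGaussianBound ℙ ξ 1)
    (hξ : Measurable ξ) {s : ℝ} (hs0 : 0 ≤ s) (hs : s < 1) :
    ∫⁻ ω, ENNReal.ofReal (Real.exp (s / 2 * (ξ ω ⬝ᵥ ξ ω))) ∂ℙ ≤
      ENNReal.ofReal ((√(1 - s))⁻¹ ^ Fintype.card ι) := by
  let γ : Measure (ι → ℝ) := Measure.pi fun _ => gaussianReal 0 1
  have hmgf : ∀ t : ℝ, ∫ g, Real.exp (t * g) ∂(gaussianReal 0 1) = Real.exp (t ^ 2 / 2) := fun t => by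
    have := mgf_gaussianReal (p := gaussianReal 0 1) (X := id) (μ := 0) (v := 1) (by simp) t
    simpa [mgf] using this
  -- A quadratic exponential is a Gaussian average of linear ones; after exchanging the integrals,
  -- the moment bound applies for each fixed direction `g`.
  have hlin : ∀ x : ι → ℝ, ∫⁻ g, ENNReal.ofReal (Real.exp ((√s • g) ⬝ᵥ x)) ∂γ =
      ENNReal.ofReal (Real.exp (s / 2 * (x ⬝ᵥ x))) := fun x => by
    have h1 := lintegral_prod_pi_gaussian (f := fun i g => Real.exp (√s * x i * g))
      (fun i g => (Real.exp_pos _).le) (fun i => integrable_exp_mul_gaussianReal _)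
    simp only [hmgf, ← Real.exp_sum] at h1
    convert h1 using 4 with g
    · simp only [dotProduct, Pi.smul_apply, smul_eq_mul]
      exact congrArg _ (Finset.sum_congr rfl fun i _ => mul_right_comm _ _ _)
    · simp only [dotProduct, mul_pow, Real.sq_sqrt hs0, Finset.mul_sum]
      exact Finset.sum_congr rfl fun i _ => by ring
  have hquad : ∫⁻ g, ENNReal.ofReal (Real.exp (s / 2 * (g ⬝ᵥ g))) ∂γ =
      ENNReal.ofReal ((√(1 - s))⁻¹ ^ Fintype.card ι) := by
    have h1 := lintegral_prod_pi_gaussian (ι := ι) (f := fun _ g => Real.exp (s / 2 * g ^ 2))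
      (fun i g => (Real.exp_pos _).le) (fun i => (integral_exp_sq_gaussianReal hs).1)
    simp only [(integral_exp_sq_gaussianReal hs).2, ← Real.exp_sum, Finset.prod_const,
      Finset.card_univ] at h1
    rw [← h1]
    refine lintegral_congr fun g => ?_
    simp only [dotProduct, Finset.mul_sum, sq]
  calc ∫⁻ ω, ENNReal.ofReal (Real.exp (s / 2 * (ξ ω ⬝ᵥ ξ ω))) ∂ℙ
      = ∫⁻ ω, ∫⁻ g, ENNReal.ofReal (Real.exp ((√s • g) ⬝ᵥ ξ ω)) ∂γ ∂ℙ := by simp only [hlin]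
    _ = ∫⁻ g, ∫⁻ ω, ENNReal.ofReal (Real.exp ((√s • g) ⬝ᵥ ξ ω)) ∂ℙ ∂γ := by
        refine lintegral_lintegral_swap (Measurable.aemeasurable ?_)
        unfold dotProduct Function.uncurry
        simp only [Pi.smul_apply, smul_eq_mul]
        fun_prop
    _ ≤ ∫⁻ g, ENNReal.ofReal (Real.exp (s / 2 * (g ⬝ᵥ g))) ∂γ := by
        refine lintegral_mono fun g => (h (√s • g)).trans (le_of_eq ?_)
        rw [sqNorm_smul, Real.sq_sqrt hs0, sqNorm, Matrix.one_mulVec]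
        congr 2; ring
    _ = _ := hquad

/-- Markov's inequality for the exponential of the squared norm, with the optimal parameter `s = a /
(1 + a)`, for which `1 - s = 1 / (1 + a)`. -/
lemma HasSubGaussianBound.measure_lt_dotProduct_self [DecidableEq ι] [MeasurableSpace Ω]
    {ℙ : Measure Ω} [IsProbabilityMeasure ℙ] {ξ : Ω → ι → ℝ} (h : HasSubGaussianBound ℙ ξ 1)
    (hξ : Measurable ξ) {a : ℝ} (ha : 0 ≤ a) :
    ℙ {ω | Fintype.card ι * (1 + a) < ξ ω ⬝ᵥ ξ ω} ≤
      ENNReal.ofReal ((√(1 + a) * Real.exp (-a / 2)) ^ Fintype.card ι) := by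
  set N : ℝ := (Fintype.card ι : ℝ)
  have ha1 : 0 < 1 + a := by linarith
  have hs0 : 0 ≤ a / (1 + a) := by positivity
  have hs : 1 - a / (1 + a) = (1 + a)⁻¹ := by field_simp; ring
  have hs1 : a / (1 + a) < 1 := by rw [div_lt_one ha1]; linarith
  have hmain := h.lintegral_exp_sq_le hξ hs0 hs1
  rw [hs, Real.sqrt_inv, inv_inv] at hmain
  have hm : Measurable fun ω => ENNReal.ofReal (Real.exp (a / (1 + a) / 2 * (ξ ω ⬝ᵥ ξ ω))) := by
    unfold dotProduct; fun_prop
  have hmarkov := mul_meas_ge_le_lintegral (μ := ℙ) hm (ENNReal.ofReal (Real.exp (a / 2 * N)))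
  have hsub : {ω | N * (1 + a) < ξ ω ⬝ᵥ ξ ω} ⊆ {ω | ENNReal.ofReal (Real.exp (a / 2 * N)) ≤
      ENNReal.ofReal (Real.exp (a / (1 + a) / 2 * (ξ ω ⬝ᵥ ξ ω)))} := fun ω hω => by
    refine ENNReal.ofReal_le_ofReal (Real.exp_le_exp.2 ?_)
    have hω' : N * (1 + a) < ξ ω ⬝ᵥ ξ ω := hω
    calc a / 2 * N = a / (1 + a) / 2 * (N * (1 + a)) := by field_simp
      _ ≤ _ := by gcongr
  have hle : ENNReal.ofReal (Real.exp (a / 2 * N)) * ℙ {ω | N * (1 + a) < ξ ω ⬝ᵥ ξ ω} ≤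
      ENNReal.ofReal (√(1 + a) ^ Fintype.card ι) :=
    (mul_le_mul_right (measure_mono hsub) _).trans (hmarkov.trans hmain)
  calc ℙ {ω | N * (1 + a) < ξ ω ⬝ᵥ ξ ω}
      = ENNReal.ofReal (Real.exp (-a / 2 * N)) * (ENNReal.ofReal (Real.exp (a / 2 * N)) *
          ℙ {ω | N * (1 + a) < ξ ω ⬝ᵥ ξ ω}) := by
        rw [← mul_assoc, ← ENNReal.ofReal_mul (Real.exp_pos _).le, ← Real.exp_add]
        have : -a / 2 * N + a / 2 * N = 0 := by ring
        rw [this, Real.exp_zero, ENNReal.ofReal_one, one_mul]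
    _ ≤ ENNReal.ofReal (Real.exp (-a / 2 * N)) * ENNReal.ofReal (√(1 + a) ^ Fintype.card ι) := by
        gcongr
    _ = _ := by
        rw [← ENNReal.ofReal_mul (Real.exp_pos _).le, mul_pow, mul_comm (-a / 2), Real.exp_nat_mul,
          mul_comm]

/-- Tail bound for the Mahalanobis norm of a sub-Gaussian vector. -/
lemma HasSubGaussianBound.measure_lt_sqNorm_inv [DecidableEq ι] [MeasurableSpace Ω]
    {ℙ : Measure Ω} [IsProbabilityMeasure ℙ] {ξ : Ω → ι → ℝ} {S : Matrix ι ι ℝ}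
    (h : HasSubGaussianBound ℙ ξ S) (hS : S.PosDef) (hξ : Measurable ξ) {a : ℝ} (ha : 0 ≤ a) :
    ℙ {ω | Fintype.card ι * (1 + a) < sqNorm S⁻¹ (ξ ω)} ≤
      ENNReal.ofReal ((√(1 + a) * Real.exp (-a / 2)) ^ Fintype.card ι) := by
  -- Whitening: `B` with `Bᵀ B = S⁻¹` turns the proxy into the identity and the Mahalanobis norm
  -- into the plain sum of squares.
  obtain ⟨B, hB⟩ := hS.inv.posSemidef.exists_transpose_mul_self
  have hSdet : IsUnit S.det := (Matrix.isUnit_iff_isUnit_det _).1 hS.isUnit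
  have hBS : B * S * Bᵀ = 1 := by
    have h1 : Bᵀ * (B * S) = 1 := by
      rw [← Matrix.mul_assoc, ← hB, Matrix.nonsing_inv_mul _ hSdet]
    exact mul_eq_one_comm.1 h1
  have h1 := h.mulVec B
  rw [hBS] at h1
  have hm : Measurable fun ω => B *ᵥ ξ ω := by
    unfold Matrix.mulVec dotProduct; fun_prop
  have h2 := h1.measure_lt_dotProduct_self hm ha
  refine le_trans (le_of_eq ?_) h2
  congr 2
  ext ω
  rw [hB, sqNorm, ← Matrix.mulVec_mulVec, Matrix.dotProduct_mulVec, Matrix.vecMul_transpose]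

end SubGaussian

/-! ### The function `κ` and its inverse -/

lemma exists_kap_eq {y : ℝ} (hy : 1 ≤ y) : ∃ a ∈ Set.Ici (0 : ℝ), kap a = y := by
  have hcont : ContinuousOn kap (Set.Icc 0 (2 * y)) := by
    unfold kap
    refine Real.continuous_exp.continuousOn.div (by fun_prop) fun x hx => ?_
    have := hx.1
    positivity
  have h0 : kap 0 = 1 := by simp [kap]
  -- From `exp (2y) ≥ 1 + 2y + 2y² ≥ y (1 + 2y)`.
  have h1 : y ≤ kap (2 * y) := by
    unfold kap
    rw [le_div_iff₀ (by positivity)]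
    have := Real.quadratic_le_exp_of_nonneg (x := 2 * y) (by positivity)
    nlinarith
  obtain ⟨a, ha, hay⟩ := intermediate_value_Icc (by positivity) hcont ⟨h0.trans_le hy, h1⟩
  exact ⟨a, ha.1, hay⟩

lemma kapInv_nonneg {y : ℝ} (hy : 1 ≤ y) : 0 ≤ kapInv y :=
  Function.invFunOn_mem (exists_kap_eq hy)

lemma kap_kapInv {y : ℝ} (hy : 1 ≤ y) : kap (kapInv y) = y :=
  Function.invFunOn_eq (exists_kap_eq hy)

/-- With `κ(a) = δ^(-1/n)` one has `(1 + a) exp (-a) = δ^(1/n)`, whose `n`-th power is the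
Gaussian-averaging tail in dimension `2n`. The confidence level is therefore attained exactly. -/
lemma kapInv_level {n : ℕ} [NeZero n] {δ : ℝ} (hδ : 0 < δ) (hδ1 : δ < 1) :
    0 ≤ kapInv (δ ^ (-(2 : ℝ) / (2 * n : ℝ))) ∧
      (√(1 + kapInv (δ ^ (-(2 : ℝ) / (2 * n : ℝ)))) *
        Real.exp (-kapInv (δ ^ (-(2 : ℝ) / (2 * n : ℝ))) / 2)) ^ (2 * n) = δ := by
  have hn : (0 : ℝ) < n := by exact_mod_cast Nat.pos_of_ne_zero (NeZero.ne n)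
  set y := δ ^ (-(2 : ℝ) / (2 * n : ℝ)) with hy
  have hy1 : 1 ≤ y :=
    Real.one_le_rpow_of_pos_of_le_one_of_nonpos hδ hδ1.le
      (div_nonpos_of_nonpos_of_nonneg (by norm_num) (by positivity))
  have ha := kapInv_nonneg hy1
  refine ⟨ha, ?_⟩
  have hk := kap_kapInv hy1
  set a := kapInv y
  have hsq : (√(1 + a) * Real.exp (-a / 2)) ^ 2 = y⁻¹ := by
    have h2 : ((2 : ℕ) : ℝ) * (-a / 2) = -a := by push_cast; ring
    rw [mul_pow, Real.sq_sqrt (by linarith), ← Real.exp_nat_mul, h2, ← hk, kap, inv_div,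
      Real.exp_neg, div_eq_mul_inv]
  rw [pow_mul, hsq, inv_pow, hy, ← Real.rpow_natCast, ← Real.rpow_mul hδ.le]
  have : -(2 : ℝ) / (2 * n : ℝ) * n = -1 := by field_simp
  rw [this, Real.rpow_neg_one, inv_inv]

/-! ### Bounds on the bias sets and on the tightened constraints -/

section Tightening

variable {n : ℕ} {D : Design n}

/-- Standing assumptions on the scenario, with a common bound `r` on disturbances and biases in
the supremum norm. -/
structure Scenario.IsBounded (S : Scenario n) (D : Design n) (r : ℝ) : Prop where
  W_nonempty : S.W.Nonempty
  M_nonempty : S.M.Nonempty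
  W_le : ∀ w ∈ S.W, ‖w‖ ≤ r
  M_le : ∀ m ∈ S.M, ‖m‖ ≤ r
  delta_pos : 0 < S.delta
  delta_lt_one : S.delta < 1
  terminal : TerminalAssumption D S

lemma Scenario.IsBounded.nonneg {S : Scenario n} {r : ℝ} (hS : S.IsBounded D r) : 0 ≤ r :=
  let ⟨w, hw⟩ := hS.W_nonempty
  (norm_nonneg w).trans (hS.W_le w hw)

lemma Scenario.IsBounded.biasSet_nonempty {S : Scenario n} {r : ℝ} (hS : S.IsBounded D r) (t : ℕ) :
    (biasSet D S t).Nonempty := by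
  induction t with
  | zero => exact Set.singleton_nonempty _
  | succ t ih => exact ((ih.image _).add (hS.W_nonempty.image _)).add (hS.M_nonempty.image _)

lemma exists_norm_biasSet_le {α : ℕ → ℝ} (hs : Summable α) (hα0 : ∀ j, 0 ≤ α j)
    (hα : ∀ j x, ‖(Ae D ^ j) *ᵥ x‖ ≤ α j * ‖x‖) :
    ∃ C : ℝ, 0 ≤ C ∧ ∀ (S : Scenario n) (r : ℝ), S.IsBounded D r →
      ∀ t, ∀ b ∈ biasSet D S t, ‖b‖ ≤ C * r := by
  obtain ⟨C₁, hC₁, h₁⟩ := exists_norm_mulVec_le (B1 D)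
  obtain ⟨C₂, hC₂, h₂⟩ := exists_norm_mulVec_le (B2 D)
  refine ⟨(∑' j, α j) * (C₁ + C₂), mul_nonneg (tsum_nonneg hα0) (by positivity),
    fun S r hS => ?_⟩
  have hr := hS.nonneg
  -- Quantifying over `k` lets the induction close: one application of `Ae` only shifts the
  -- exponent, and the sums stay below the total of `α`.
  have key : ∀ t, ∀ b ∈ biasSet D S t, ∀ k,
      ‖(Ae D ^ k) *ᵥ b‖ ≤ (∑ j ∈ Finset.range t, α (j + k)) * ((C₁ + C₂) * r) := by
    intro t
    induction t with
    | zero =>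
      intro b hb k
      rw [Set.mem_singleton_iff.1 hb]
      simp
    | succ t ih =>
      intro b hb k
      obtain ⟨_, ⟨_, ⟨b', hb', rfl⟩, _, ⟨w, hw, rfl⟩, rfl⟩, _, ⟨m, hm, rfl⟩, rfl⟩ := hb
      have hwm : ‖B1 D *ᵥ w + B2 D *ᵥ m‖ ≤ (C₁ + C₂) * r := by
        refine (norm_add_le _ _).trans ?_
        rw [add_mul]
        refine add_le_add ((h₁ w).trans ?_) ((h₂ m).trans ?_)
        · exact mul_le_mul_of_nonneg_left (hS.W_le w hw) hC₁
        · exact mul_le_mul_of_nonneg_left (hS.M_le m hm) hC₂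
      have h3 := ih b' hb' (k + 1)
      have h4 := (hα k (B1 D *ᵥ w + B2 D *ᵥ m)).trans (mul_le_mul_of_nonneg_left hwm (hα0 k))
      simp only
      rw [add_assoc, Matrix.mulVec_add, Matrix.mulVec_mulVec, ← pow_succ, Finset.sum_range_succ',
        add_mul, zero_add]
      refine (norm_add_le _ _).trans (add_le_add (h3.trans (le_of_eq ?_)) h4)
      congr 1
      exact Finset.sum_congr rfl fun j _ => congrArg α (by omega)
  intro t b hb
  have h := key t b hb 0
  simp only [pow_zero, Matrix.one_mulVec, add_zero] at h
  rw [mul_assoc]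
  exact h.trans (mul_le_mul_of_nonneg_right (hs.sum_le_tsum _ fun j _ => hα0 j) (by positivity))

lemma zero_mem_confSet [NeZero n] {S : Scenario n} (h0 : 0 < S.delta) (h1 : S.delta < 1) (t : ℕ) :
    (0 : Vec2 n) ∈ confSet D S t := by
  have := (kapInv_level (n := n) h0 h1).1
  simp only [confSet, Set.mem_ofPred_eq, sqNorm_zero]
  positivity

/-- The error set contains some `Ke b` with `b` in the bias set, since the ellipsoid contains zero.
Then `v` plus the input block of `Ke b` lies in `U`, and both are bounded without reference to `X`
or `Zf`. -/
lemma exists_norm_input_le_of_mem_tightened [NeZero n] {α : ℕ → ℝ} (hs : Summable α)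
    (hα0 : ∀ j, 0 ≤ α j) (hα : ∀ j x, ‖(Ae D ^ j) *ᵥ x‖ ≤ α j * ‖x‖)
    (hU : Bornology.IsBounded D.U) :
    ∃ C : ℝ, 0 ≤ C ∧ ∀ (S : Scenario n) (r : ℝ), S.IsBounded D r → ∀ t (z v : Vec n),
      Sum.elim z v ∈ tightened D S t → ‖v‖ ≤ C * (1 + r) := by
  obtain ⟨C₁, hC₁, h₁⟩ := exists_norm_biasSet_le hs hα0 hα
  obtain ⟨C₂, hC₂, h₂⟩ := exists_norm_mulVec_le (Ke D)
  obtain ⟨R, hR0, hR⟩ := hU.exists_pos_norm_le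
  refine ⟨R + C₂ * C₁, by positivity, fun S r hS t z v hzv => ?_⟩
  have hr := hS.nonneg
  obtain ⟨b, hb⟩ := hS.biasSet_nonempty t
  have hmem : Ke D *ᵥ b ∈ errSet D S t := by
    have := Set.add_mem_add (zero_mem_confSet (D := D) hS.delta_pos hS.delta_lt_one t)
      (Set.mem_image_of_mem (fun e => Ke D *ᵥ e) hb)
    rwa [zero_add] at this
  have h3 := hR _ (hzv _ hmem).2
  have h4 : ‖fun i => (Ke D *ᵥ b) (Sum.inr i)‖ ≤ C₂ * (C₁ * r) :=
    (norm_inr_le _).trans ((h₂ b).trans (mul_le_mul_of_nonneg_left (h₁ S r hS t b hb) hC₂))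
  have h5 : v = (fun i => (Sum.elim z v + Ke D *ᵥ b) (Sum.inr i)) -
      fun i => (Ke D *ᵥ b) (Sum.inr i) := by
    ext i; simp
  calc ‖v‖ ≤ R + C₂ * (C₁ * r) := by
        rw [h5]
        exact (norm_sub_le _ _).trans (add_le_add h3 h4)
    _ ≤ _ := by nlinarith [mul_nonneg hR0.le hr, mul_nonneg hC₂ hC₁]

end Tightening

/-! ### Plans as sequences -/

section Plans

variable {n H : ℕ} {D : Design n} {S : Scenario n} {t : ℕ} {xh z0 : Vec n}

/-- The plan that reads off the first entries of given sequences. -/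
def Plan.ofSeq (H : ℕ) (v u z x : ℕ → Vec n) : Plan n H :=
  ⟨fun i => v i, fun i => u i, fun i => z i, fun i => x i⟩

lemma Plan.cost_ofSeq (D : Design n) (v u z x : ℕ → Vec n) :
    (Plan.ofSeq H v u z x).cost D =
      terminalCost D (x H) + ∑ i ∈ Finset.range H, stageCost D (x i) (u i) := by
  simp only [Plan.cost, Plan.ofSeq, Fin.val_last, Fin.val_castSucc]
  rw [Fin.sum_univ_eq_sum_range fun i => stageCost D (x i) (u i)]

/-- Sequences that satisfy the constraints of the MPC problem up to the horizon, and follow the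
terminal controller in the step after it. -/
structure IsExtendedPlan (D : Design n) (S : Scenario n) (H t : ℕ) (v u z x : ℕ → Vec n) :
    Prop where
  z_succ : ∀ i ≤ H, z (i + 1) = z i + v i
  input : ∀ i ≤ H, u i = v i + D.K *ᵥ (x i - z i)
  x_succ : ∀ i ≤ H, x (i + 1) = x i + u i
  cons : ∀ i ≤ H, Sum.elim (z i) (v i) ∈ tightened D S (t + i)
  terminal : z H ∈ S.Zf
  v_last : v H = D.K *ᵥ z H

lemma Plan.IsFeasible.exists_extension {p : Plan n H} (hp : p.IsFeasible D S t xh z0)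
    (hterm : TerminalAssumption D S) :
    ∃ v u z x : ℕ → Vec n, p = Plan.ofSeq H v u z x ∧ IsExtendedPlan D S H t v u z x := by
  -- The inputs are extended at index `H` by the terminal feedback, the states at `H + 1` by its
  -- effect. Values beyond these indices are never used.
  refine ⟨fun i => if h : i < H then p.v ⟨i, h⟩ else D.K *ᵥ p.z (Fin.last H),
    fun i => if h : i < H then p.u ⟨i, h⟩ else D.K *ᵥ p.xbar (Fin.last H),
    fun i => if h : i < H + 1 then p.z ⟨i, h⟩ else (1 + D.K) *ᵥ p.z (Fin.last H),
    fun i => if h : i < H + 1 then p.xbar ⟨i, h⟩ else (1 + D.K) *ᵥ p.xbar (Fin.last H), ?_, ?_⟩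
  · cases p
    simp [Plan.ofSeq, Fin.is_le]
  · constructor
    · intro i hi
      rcases hi.lt_or_eq with h | rfl
      · simpa [h, Nat.lt_succ_of_lt h] using hp.z_succ ⟨i, h⟩
      · simp only [lt_irrefl, Nat.lt_succ_self, dite_true, dite_false, Matrix.add_mulVec,
          Matrix.one_mulVec]
        rfl
    · intro i hi
      rcases hi.lt_or_eq with h | rfl
      · simpa [h, Nat.lt_succ_of_lt h] using hp.input ⟨i, h⟩
      · simp only [lt_irrefl, Nat.lt_succ_self, dite_true, dite_false, Matrix.mulVec_sub]
        exact (add_sub_cancel _ _).symm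
    · intro i hi
      rcases hi.lt_or_eq with h | rfl
      · simpa [h, Nat.lt_succ_of_lt h] using hp.x_succ ⟨i, h⟩
      · simp only [lt_irrefl, Nat.lt_succ_self, dite_true, dite_false, Matrix.add_mulVec,
          Matrix.one_mulVec]
        rfl
    · intro i hi
      rcases hi.lt_or_eq with h | rfl
      · simpa [h, Nat.lt_succ_of_lt h] using hp.cons ⟨i, h⟩
      · simp only [lt_irrefl, Nat.lt_succ_self, dite_true, dite_false]
        exact hterm.constraints _ hp.terminal (t + i)
    · simp only [Nat.lt_succ_self, dite_true]
      exact hp.terminal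
    · simp only [lt_irrefl, Nat.lt_succ_self, dite_true, dite_false]
      rfl

/-- The planned input cancels in the difference, leaving the autonomous recursion with matrix `1 +
K`. -/
lemma IsExtendedPlan.sub_eq {v u z x : ℕ → Vec n} (h : IsExtendedPlan D S H t v u z x) {i : ℕ}
    (hi : i ≤ H + 1) : x i - z i = ((1 + D.K) ^ i) *ᵥ (x 0 - z 0) := by
  induction i with
  | zero => simp
  | succ i ih =>
    have hi' : i ≤ H := Nat.succ_le_succ_iff.1 hi
    rw [pow_succ', ← Matrix.mulVec_mulVec, ← ih (Nat.le_succ_of_le hi'), h.x_succ i hi',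
      h.z_succ i hi', h.input i hi', Matrix.add_mulVec, Matrix.one_mulVec]
    abel

/-- Shifting a plan by one step, with the estimate perturbed by `d`. -/
lemma IsExtendedPlan.shift_feasible {v u z x : ℕ → Vec n} (h : IsExtendedPlan D S H t v u z x)
    (hterm : TerminalAssumption D S) (d : Vec n) :
    (Plan.ofSeq H (fun i => v (i + 1)) (fun i => u (i + 1) + D.K *ᵥ ((1 + D.K) ^ i) *ᵥ d)
      (fun i => z (i + 1)) (fun i => x (i + 1) + ((1 + D.K) ^ i) *ᵥ d)).IsFeasible D S (t + 1)
      (x 0 + u 0 + d) (z 0 + v 0) := by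
  -- The perturbation `d` does not touch `z` and `v`: the constraint at `(t + 1) + i` is the old one
  -- at `t + (i + 1)`, the last of them coming from the appended step. The terminal constraint
  -- follows from invariance of `Zf`.
  constructor
  · intro i
    exact h.z_succ _ i.2
  · intro i
    simp only [Plan.ofSeq, Fin.val_castSucc]
    rw [h.input _ i.2, add_sub_right_comm, Matrix.mulVec_add, add_assoc]
  · intro i
    simp only [Plan.ofSeq, Fin.val_castSucc, Fin.val_succ]
    rw [h.x_succ _ i.2, pow_succ', ← Matrix.mulVec_mulVec, Matrix.add_mulVec 1 D.K,
      Matrix.one_mulVec]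
    abel
  · intro i
    have := h.cons _ i.2
    rwa [Nat.succ_eq_add_one, add_comm (i : ℕ) 1, ← add_assoc, add_comm 1 (i : ℕ)] at this
  · have := hterm.invariant _ h.terminal
    rwa [Matrix.add_mulVec, Matrix.one_mulVec, ← h.v_last, ← h.z_succ H le_rfl] at this
  · simp [Plan.ofSeq, h.x_succ 0 (Nat.zero_le _)]
  · simp [Plan.ofSeq, h.z_succ 0 (Nat.zero_le _)]

end Plans

/-! ### Growth of the cost along shifted plans -/

section Cost

variable {n H : ℕ} {D : Design n}

/-- The increments vanish with the perturbation size `b`, but only linearly, with a slope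
proportional to the size `a` of the unperturbed point. -/
lemma exists_cost_bounds (D : Design n) :
    ∃ C : ℝ, 0 ≤ C ∧ ∀ (x u h k : Vec n) (a b : ℝ), ‖x‖ ≤ a → ‖u‖ ≤ a → ‖h‖ ≤ b → ‖k‖ ≤ b →
      stageCost D x u ≤ C * a ^ 2 ∧ terminalCost D x ≤ C * a ^ 2 ∧
      stageCost D (x + h) (u + k) ≤ stageCost D x u + C * (a * b + b ^ 2) ∧
      terminalCost D (x + h) ≤ terminalCost D x + C * (a * b + b ^ 2) := by
  have hgen : ∀ V : Mat n, ∃ C : ℝ, 0 ≤ C ∧ ∀ (x h : Vec n) (a b : ℝ), ‖x‖ ≤ a → ‖h‖ ≤ b →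
      sqNorm V x ≤ C * a ^ 2 ∧ sqNorm V (x + h) ≤ sqNorm V x + C * (a * b + b ^ 2) := fun V => by
    obtain ⟨C, hC, h1, h2⟩ := exists_sqNorm_le V
    refine ⟨C, hC, fun x h a b ha hb => ⟨(h1 x).trans (by gcongr), (h2 x h).trans ?_⟩⟩
    have := (norm_nonneg x).trans ha
    gcongr
  obtain ⟨CQ, hCQ, hQ⟩ := hgen D.Q
  obtain ⟨CR, hCR, hR⟩ := hgen D.R
  obtain ⟨CP, hCP, hP⟩ := hgen D.P
  refine ⟨CQ + CR + CP, by positivity, fun x u h k a b hx hu hh hk => ?_⟩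
  obtain ⟨q1, q2⟩ := hQ x h a b hx hh
  obtain ⟨r1, r2⟩ := hR u k a b hu hk
  obtain ⟨p1, p2⟩ := hP x h a b hx hh
  have ha := (norm_nonneg x).trans hx
  have hb := (norm_nonneg h).trans hh
  have hab : 0 ≤ a * b + b ^ 2 := by positivity
  have ha2 : 0 ≤ a ^ 2 := by positivity
  have e1 := mul_nonneg hCQ hab
  have e2 := mul_nonneg hCR hab
  have e3 := mul_nonneg hCP hab
  have f1 := mul_nonneg hCQ ha2
  have f2 := mul_nonneg hCR ha2
  have f3 := mul_nonneg hCP ha2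
  unfold stageCost terminalCost
  rw [add_mul, add_mul, add_mul, add_mul]
  refine ⟨?_, ?_, ?_, ?_⟩ <;> linarith

lemma stageCost_nonneg (hQ : D.Q.PosSemidef) (hR : D.R.PosSemidef) (x u : Vec n) :
    0 ≤ stageCost D x u := by
  have := hQ.sqNorm_nonneg x
  have := hR.sqNorm_nonneg u
  unfold stageCost
  positivity

lemma terminalCost_lyapunov
    (hP : (1 + D.K)ᵀ * D.P * (1 + D.K) + D.Q + D.Kᵀ * D.R * D.K = D.P) (x : Vec n) :
    terminalCost D x = terminalCost D (x + D.K *ᵥ x) + stageCost D x (D.K *ᵥ x) := by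
  have := sqNorm_lyapunov hP x
  rw [Matrix.add_mulVec, Matrix.one_mulVec] at this
  unfold terminalCost stageCost
  linarith

/-- Bounds on a plan that are uniform over scenarios. They rest on `v H = K z_H`: a bounded input
and an invertible `K` bound the terminal nominal state even though `Zf` may be unbounded. -/
lemma IsExtendedPlan.exists_norm_le [NeZero n] {α : ℕ → ℝ} (hs : Summable α) (hα0 : ∀ j, 0 ≤ α j)
    (hα : ∀ j x, ‖(Ae D ^ j) *ᵥ x‖ ≤ α j * ‖x‖) (hU : Bornology.IsBounded D.U) (H : ℕ) :
    ∃ C : ℝ, 0 ≤ C ∧ ∀ (S : Scenario n) (r : ℝ), S.IsBounded D r → ∀ t (v u z x : ℕ → Vec n),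
      IsExtendedPlan D S H t v u z x →
        (∀ i ≤ H, ‖u i‖ ≤ C * (1 + r + ‖x 0 - z 0‖)) ∧
        ∀ i ≤ H + 1, ‖x i‖ ≤ C * (1 + r + ‖x 0 - z 0‖) := by
  obtain ⟨Cv, hCv, hv⟩ := exists_norm_input_le_of_mem_tightened hs hα0 hα hU
  obtain ⟨Ci, hCi, hi⟩ := exists_norm_le_norm_K hs hα
  obtain ⟨Ck, hCk, hk⟩ := exists_norm_mulVec_le D.K
  set Γ := ∑' j, α j
  have hΓ : 0 ≤ Γ := tsum_nonneg hα0
  have hαΓ : ∀ j, α j ≤ Γ := fun j => hs.le_tsum j fun i _ => hα0 i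
  refine ⟨(Ci + H + 1) * Cv + Cv + Γ + Ck * Γ, by positivity, fun S r hS t v u z x h => ?_⟩
  have hr := hS.nonneg
  have hvb : ∀ i ≤ H, ‖v i‖ ≤ Cv * (1 + r) := fun i hi => hv S r hS _ _ _ (h.cons i hi)
  have hzH : ‖z H‖ ≤ Ci * (Cv * (1 + r)) := by
    refine (hi _).trans (mul_le_mul_of_nonneg_left ?_ hCi)
    rw [← h.v_last]
    exact hvb H le_rfl
  have hρ : 0 ≤ Cv * (1 + r) := by positivity
  -- Backwards from the terminal state through `z_i = z_{i+1} - v_i`, each step costing one input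
  -- bound.
  have hzb : ∀ k ≤ H, ‖z (H - k)‖ ≤ (Ci + k) * (Cv * (1 + r)) := fun k => by
    induction k with
    | zero => intro _; simpa using hzH
    | succ k ih =>
      intro hk
      have h1 := ih (Nat.le_of_succ_le hk)
      have h2 := h.z_succ (H - (k + 1)) (Nat.sub_le _ _)
      rw [show H - (k + 1) + 1 = H - k by omega] at h2
      have h3 := hvb (H - (k + 1)) (Nat.sub_le _ _)
      rw [eq_sub_of_add_eq h2.symm]
      refine (norm_sub_le _ _).trans ((add_le_add h1 h3).trans (le_of_eq ?_))
      push_cast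
      ring
  have hz : ∀ i ≤ H + 1, ‖z i‖ ≤ (Ci + H + 1) * (Cv * (1 + r)) := fun i hi => by
    rcases hi.lt_or_eq with hi | rfl
    · have h1 := hzb (H - i) (Nat.sub_le _ _)
      rw [Nat.sub_sub_self (Nat.le_of_lt_succ hi)] at h1
      refine h1.trans (mul_le_mul_of_nonneg_right ?_ hρ)
      have : ((H - i : ℕ) : ℝ) ≤ H := by exact_mod_cast Nat.sub_le _ _
      linarith
    · rw [h.z_succ H le_rfl]
      refine (norm_add_le _ _).trans ((add_le_add hzH (hvb H le_rfl)).trans ?_)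
      nlinarith [mul_nonneg (Nat.cast_nonneg H : (0 : ℝ) ≤ H) hρ]
  have hxz : ∀ i ≤ H + 1, ‖x i - z i‖ ≤ Γ * ‖x 0 - z 0‖ := fun i hi => by
    rw [h.sub_eq hi]
    exact (norm_pow_one_add_K_mulVec_le hα i _).trans
      (mul_le_mul_of_nonneg_right (hαΓ i) (norm_nonneg _))
  have hg := norm_nonneg (x 0 - z 0)
  set g := ‖x 0 - z 0‖
  have hH : (0 : ℝ) ≤ H := Nat.cast_nonneg H
  have m1 : 0 ≤ (Ci + H + 1) * Cv := by positivity
  have m2 : 0 ≤ Ck * Γ := by positivity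
  constructor
  · intro i hi
    rw [h.input i hi]
    calc ‖v i + D.K *ᵥ (x i - z i)‖ ≤ Cv * (1 + r) + Ck * (Γ * g) :=
          (norm_add_le _ _).trans (add_le_add (hvb i hi) ((hk _).trans
            (mul_le_mul_of_nonneg_left (hxz i (Nat.le_succ_of_le hi)) hCk)))
      _ = Cv * (1 + r) + (Ck * Γ) * g := by ring
      _ ≤ _ := by
        rw [← sub_nonneg]
        have : ((Ci + H + 1) * Cv + Cv + Γ + Ck * Γ) * (1 + r + g) - (Cv * (1 + r) + (Ck * Γ) * g) =
          ((Ci + H + 1) * Cv + Γ) * (1 + r + g) + Cv * g + (Ck * Γ) * (1 + r) := by ring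
        rw [this]; positivity
  · intro i hi
    calc ‖x i‖ = ‖z i + (x i - z i)‖ := by rw [add_sub_cancel]
      _ ≤ (Ci + H + 1) * (Cv * (1 + r)) + Γ * g :=
          (norm_add_le _ _).trans (add_le_add (hz i hi) (hxz i hi))
      _ ≤ _ := by
        rw [← sub_nonneg]
        have : ((Ci + H + 1) * Cv + Cv + Γ + Ck * Γ) * (1 + r + g) -
            ((Ci + H + 1) * (Cv * (1 + r)) + Γ * g) =
          (Cv + Ck * Γ) * (1 + r + g) + (Ci + H + 1) * Cv * g + Γ * (1 + r) := by ring
        rw [this]; positivity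

/-- From a feasible plan: a bound on its cost and, after any perturbation `d` of the predicted
estimate, a feasible plan for the next step whose cost has decreased by the stage cost, up to
an error that vanishes with `d`. -/
lemma exists_plan_descent [NeZero n] [NeZero H] {α : ℕ → ℝ} (hs : Summable α)
    (hα0 : ∀ j, 0 ≤ α j) (hα : ∀ j x, ‖(Ae D ^ j) *ᵥ x‖ ≤ α j * ‖x‖)
    (hU : Bornology.IsBounded D.U)
    (hP : (1 + D.K)ᵀ * D.P * (1 + D.K) + D.Q + D.Kᵀ * D.R * D.K = D.P) :
    ∃ C : ℝ, 0 ≤ C ∧ ∀ (S : Scenario n) (r : ℝ), S.IsBounded D r → ∀ t (xh z0 : Vec n)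
      (p : Plan n H), p.IsFeasible D S t xh z0 →
        p.cost D ≤ C * (1 + r + ‖xh - z0‖) ^ 2 ∧
        ∀ d : Vec n, ∃ q : Plan n H,
          q.IsFeasible D S (t + 1) (xh + p.u 0 + d) (z0 + p.v 0) ∧
          q.cost D ≤ p.cost D - stageCost D xh (p.u 0) +
            C * ((1 + r + ‖xh - z0‖) * ‖d‖ + ‖d‖ ^ 2) := by
  obtain ⟨Cb, hCb, hb⟩ := IsExtendedPlan.exists_norm_le hs hα0 hα hU H
  obtain ⟨Cc, hCc, hc⟩ := exists_cost_bounds D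
  obtain ⟨Ck, hCk, hk⟩ := exists_norm_mulVec_le D.K
  set Γ := ∑' j, α j
  have hΓ : 0 ≤ Γ := tsum_nonneg hα0
  have hαΓ : ∀ j, α j ≤ Γ := fun j => hs.le_tsum j fun i _ => hα0 i
  -- One constant covers both the state perturbation `(1 + K) ^ i d` and the input perturbation `K
  -- (1 + K) ^ i d`.
  set E := (1 + Ck) * Γ with hE
  have hE0 : 0 ≤ E := by positivity
  have hH : (0 : ℝ) ≤ H := Nat.cast_nonneg H
  refine ⟨(H + 1) * Cc * (Cb ^ 2 + Cb * E + E ^ 2), by positivity,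
    fun S r hS t xh z0 p hp => ?_⟩
  have hr := hS.nonneg
  obtain ⟨v, u, z, x, rfl, h⟩ := hp.exists_extension hS.terminal
  have hx0 : x 0 = xh := hp.x_init
  have hz0 : z 0 = z0 := hp.z_init
  obtain ⟨hub, hxb⟩ := hb S r hS t v u z x h
  rw [hx0, hz0] at hub hxb
  have hg := norm_nonneg (xh - z0)
  set g := 1 + r + ‖xh - z0‖
  have hg0 : 0 ≤ g := by positivity
  have hcost := Plan.cost_ofSeq (H := H) D v u z x
  constructor
  · rw [hcost]
    have h1 : terminalCost D (x H) ≤ Cc * (Cb * g) ^ 2 :=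
      (hc (x H) (x H) (x H) (x H) _ _ (hxb H (Nat.le_succ H)) (hxb H (Nat.le_succ H)) le_rfl le_rfl).2.1
    have h2 : ∑ i ∈ Finset.range H, stageCost D (x i) (u i) ≤ H * (Cc * (Cb * g) ^ 2) := by
      have h3 : ∀ i ∈ Finset.range H, stageCost D (x i) (u i) ≤ Cc * (Cb * g) ^ 2 := fun i hi => by
        have hi' := (Finset.mem_range.1 hi).le
        exact (hc (x i) (u i) (x i) (x i) _ _ (hxb i (Nat.le_succ_of_le hi')) (hub i hi')
          le_rfl le_rfl).1
      simpa using Finset.sum_le_sum h3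
    calc _ ≤ (H + 1) * Cc * Cb ^ 2 * g ^ 2 := by linarith
      _ ≤ _ := by
        refine mul_le_mul_of_nonneg_right ?_ (by positivity)
        refine mul_le_mul_of_nonneg_left ?_ (by positivity)
        nlinarith [mul_nonneg hCb hE0, sq_nonneg E]
  · intro d
    have hq := h.shift_feasible hS.terminal d
    rw [hx0, hz0] at hq
    refine ⟨_, hq, ?_⟩
    rw [Plan.cost_ofSeq, hcost]
    set b := E * ‖d‖
    have hd1 : ∀ i, ‖((1 + D.K) ^ i) *ᵥ d‖ ≤ Γ * ‖d‖ := fun i =>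
      (norm_pow_one_add_K_mulVec_le hα i d).trans
        (mul_le_mul_of_nonneg_right (hαΓ i) (norm_nonneg _))
    have hd0 := norm_nonneg d
    have hd2 : ∀ i, ‖((1 + D.K) ^ i) *ᵥ d‖ ≤ b := fun i => (hd1 i).trans
      (mul_le_mul_of_nonneg_right (by rw [hE]; nlinarith [mul_nonneg hCk hΓ]) hd0)
    have hd3 : ∀ i, ‖D.K *ᵥ ((1 + D.K) ^ i) *ᵥ d‖ ≤ b := fun i =>
      (hk _).trans ((mul_le_mul_of_nonneg_left (hd1 i) hCk).trans (by
        rw [← mul_assoc]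
        exact mul_le_mul_of_nonneg_right (by rw [hE]; nlinarith) hd0))
    have hterm := (hc _ _ _ _ _ _ (hxb (H + 1) le_rfl) (hub H le_rfl) (hd2 H) (hd2 H)).2.2.2
    have hstage : ∑ i ∈ Finset.range H, stageCost D (x (i + 1) + ((1 + D.K) ^ i) *ᵥ d)
          (u (i + 1) + D.K *ᵥ ((1 + D.K) ^ i) *ᵥ d) ≤
        ∑ i ∈ Finset.range H, stageCost D (x (i + 1)) (u (i + 1)) +
          H * (Cc * (Cb * g * b + b ^ 2)) := by
      have h3 : ∀ i ∈ Finset.range H, stageCost D (x (i + 1) + ((1 + D.K) ^ i) *ᵥ d)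
          (u (i + 1) + D.K *ᵥ ((1 + D.K) ^ i) *ᵥ d) ≤
          stageCost D (x (i + 1)) (u (i + 1)) + Cc * (Cb * g * b + b ^ 2) := fun i hi => by
        have hi' : i + 1 ≤ H := Finset.mem_range.1 hi
        exact (hc _ _ _ _ _ _ (hxb (i + 1) (Nat.le_succ_of_le hi')) (hub (i + 1) hi')
          (hd2 i) (hd3 i)).2.2.1
      simpa [Finset.sum_add_distrib] using Finset.sum_le_sum h3
    -- The shifted sum loses the stage cost at `0` and gains the one at `H`; the Lyapunov equation
    -- pays exactly for the latter by the drop in terminal cost.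
    have htel := Finset.sum_range_succ' (fun i => stageCost D (x i) (u i)) H
    rw [Finset.sum_range_succ] at htel
    have huH : u H = D.K *ᵥ x H := by
      rw [h.input H le_rfl, h.v_last, Matrix.mulVec_sub, add_sub_cancel]
    have hlyap := terminalCost_lyapunov hP (x H)
    rw [← huH, ← h.x_succ H le_rfl] at hlyap
    have hu0 : (Plan.ofSeq H v u z x).u 0 = u 0 := by simp [Plan.ofSeq]
    rw [hu0, ← hx0]
    have herr : (H + 1) * (Cc * (Cb * g * b + b ^ 2)) ≤
        (H + 1) * Cc * (Cb ^ 2 + Cb * E + E ^ 2) * (g * ‖d‖ + ‖d‖ ^ 2) := by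
      have e : Cb * g * b + b ^ 2 = Cb * E * (g * ‖d‖) + E ^ 2 * ‖d‖ ^ 2 := by ring
      rw [e, ← mul_assoc, mul_assoc ((H + 1 : ℝ) * Cc)]
      refine mul_le_mul_of_nonneg_left ?_ (by positivity)
      have f1 : 0 ≤ g * ‖d‖ := by positivity
      have f2 : 0 ≤ ‖d‖ ^ 2 := by positivity
      nlinarith [mul_nonneg (sq_nonneg Cb) f1, mul_nonneg (sq_nonneg Cb) f2,
        mul_nonneg (mul_nonneg hCb hE0) f2, mul_nonneg (sq_nonneg E) f1]
    linarith

end Cost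

/-! ### Errors of the closed loop -/

section ClosedLoop

variable {n H : ℕ} {Ω : Type*} {D : Design n} {S : Scenario n}

/-- The error `[x̂ - x; x - z]`. -/
def loopErr (s : Signals Ω n) (t : ℕ) (ω : Ω) : Vec2 n :=
  Sum.elim (s.xh t ω - s.x t ω) (s.x t ω - s.z t ω)

/-- The part of the error that is driven by the initial error and the measurement noise. -/
def stochErr (D : Design n) (S : Scenario n) (s : Signals Ω n) : ℕ → Ω → Vec2 n
  | 0 => fun ω => Sum.elim (s.xh 0 ω - s.x 0 ω) (s.x 0 ω - S.mu0)
  | t + 1 => fun ω => Ae D *ᵥ stochErr D S s t ω + B2 D *ᵥ s.eps (t + 1) ω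

/-- The innovation applied by the observer. -/
def innovation (D : Design n) (s : Signals Ω n) (t : ℕ) (ω : Ω) : Vec n :=
  D.L *ᵥ (-(s.xh t ω - s.x t ω) + s.w t ω + s.m (t + 1) ω + s.eps (t + 1) ω)

variable [mΩ : MeasurableSpace Ω] [NeZero H] {s : Signals Ω n}

lemma IsClosedLoop.xh_succ (hl : IsClosedLoop H D S s) (t : ℕ) (ω : Ω) :
    s.xh (t + 1) ω = s.xh t ω + s.u t ω + innovation D s t ω := by
  rw [hl.observer, innovation]
  congr 2
  rw [hl.measurement, hl.dynamics]
  abel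

lemma IsClosedLoop.loopErr_succ (hl : IsClosedLoop H D S s) (t : ℕ) (ω : Ω) :
    loopErr s (t + 1) ω = Ae D *ᵥ loopErr s t ω + B1 D *ᵥ s.w t ω +
      B2 D *ᵥ (s.m (t + 1) ω + s.eps (t + 1) ω) := by
  have h1 : s.xh (t + 1) ω - s.x (t + 1) ω = (1 - D.L) *ᵥ (s.xh t ω - s.x t ω) +
      (-(1 - D.L)) *ᵥ s.w t ω + D.L *ᵥ (s.m (t + 1) ω + s.eps (t + 1) ω) := by
    rw [hl.xh_succ, hl.dynamics, innovation]
    simp only [Matrix.sub_mulVec, Matrix.neg_mulVec, Matrix.one_mulVec, Matrix.mulVec_add,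
      Matrix.mulVec_neg]
    abel
  have h2 : s.x (t + 1) ω - s.z (t + 1) ω = D.K *ᵥ (s.xh t ω - s.x t ω) +
      (1 + D.K) *ᵥ (s.x t ω - s.z t ω) + s.w t ω := by
    have h3 : s.xh t ω - s.z t ω = (s.xh t ω - s.x t ω) + (s.x t ω - s.z t ω) := by abel
    rw [hl.dynamics, hl.nominal, hl.input, h3]
    simp only [Matrix.add_mulVec, Matrix.one_mulVec, Matrix.mulVec_add]
    abel
  rw [loopErr, h1, h2, loopErr, Ae, B1, B2, Matrix.fromBlocks_mulVec, Matrix.fromRows_mulVec,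
    Matrix.fromRows_mulVec]
  ext i
  rcases i with i | i <;> simp

lemma IsClosedLoop.sub_eq_Ke_mulVec (hl : IsClosedLoop H D S s) (t : ℕ) (ω : Ω) :
    (Sum.elim (s.x t ω) (s.u t ω) : Vec2 n) =
      Sum.elim (s.z t ω) (s.v t ω) + Ke D *ᵥ loopErr s t ω := by
  have h3 : s.xh t ω - s.z t ω = (s.xh t ω - s.x t ω) + (s.x t ω - s.z t ω) := by abel
  rw [hl.input, h3, Matrix.mulVec_add, loopErr, Ke, Matrix.fromBlocks_mulVec]
  ext i
  rcases i with i | i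
  · simp
  · simp [add_comm]

/-- Both errors obey the same linear recursion, so their difference starts at zero and is driven by
`w` and `m` alone. -/
lemma IsClosedLoop.loopErr_sub_stochErr_mem (hl : IsClosedLoop H D S s)
    (hw : ∀ t ω, s.w t ω ∈ S.W) (hm : ∀ t ω, s.m t ω ∈ S.M) (t : ℕ) (ω : Ω) :
    loopErr s t ω - stochErr D S s t ω ∈ biasSet D S t := by
  induction t with
  | zero => simp [loopErr, stochErr, biasSet, hl.nominal_init]
  | succ t ih =>
    have : loopErr s (t + 1) ω - stochErr D S s (t + 1) ω =
        Ae D *ᵥ (loopErr s t ω - stochErr D S s t ω) + B1 D *ᵥ s.w t ω + B2 D *ᵥ s.m (t + 1) ω := by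
      have h1 : stochErr D S s (t + 1) ω =
        Ae D *ᵥ stochErr D S s t ω + B2 D *ᵥ s.eps (t + 1) ω := rfl
      rw [hl.loopErr_succ, h1, Matrix.mulVec_add, Matrix.mulVec_sub]
      abel
    rw [this]
    exact Set.add_mem_add (Set.add_mem_add (Set.mem_image_of_mem _ ih)
      (Set.mem_image_of_mem _ (hw t ω))) (Set.mem_image_of_mem _ (hm (t + 1) ω))

lemma IsClosedLoop.plan_input_eq (hl : IsClosedLoop H D S s) {t : ℕ} {ω : Ω} {p : Plan n H}
    (hp : p.IsFeasible D S t (s.xh t ω) (s.z t ω)) (hv : s.v t ω = p.v 0) :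
    p.u 0 = s.u t ω := by
  have h1 := hp.input 0
  rw [Fin.castSucc_zero', hp.x_init, hp.z_init, ← hv] at h1
  rw [h1, hl.input, add_comm]

/-- Recursive feasibility. -/
lemma IsClosedLoop.mpcFeasible (hl : IsClosedLoop H D S s) (hterm : TerminalAssumption D S)
    {ω : Ω} (h0 : MPCFeasible H D S 0 (s.xh 0 ω) (s.z 0 ω)) (t : ℕ) :
    MPCFeasible H D S t (s.xh t ω) (s.z t ω) := by
  induction t with
  | zero => exact h0
  | succ t ih =>
    obtain ⟨p, hp, hv⟩ := hl.mpc t ω ih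
    have hu := hl.plan_input_eq hp.1 hv
    have hp' := hp.1
    obtain ⟨v, u, z, x, rfl, h⟩ := hp.1.exists_extension hterm
    have hq := h.shift_feasible hterm (innovation D s t ω)
    have hx : x 0 = s.xh t ω := hp'.x_init
    have hz : z 0 = s.z t ω := hp'.z_init
    have hu' : u 0 = s.u t ω := by simpa [Plan.ofSeq] using hu
    have hv' : v 0 = s.v t ω := by simpa [Plan.ofSeq] using hv.symm
    rw [hx, hz, hu', hv', ← hl.xh_succ, ← hl.nominal] at hq
    exact ⟨_, hq⟩

/-- Pathwise bound on the accumulated cost. -/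
lemma exists_sum_stageCost_le [NeZero n] {α : ℕ → ℝ} (hs : Summable α)
    (hα0 : ∀ j, 0 ≤ α j) (hα : ∀ j x, ‖(Ae D ^ j) *ᵥ x‖ ≤ α j * ‖x‖)
    (hU : Bornology.IsBounded D.U) (hQ : D.Q.PosSemidef) (hR : D.R.PosSemidef)
    (hP : (1 + D.K)ᵀ * D.P * (1 + D.K) + D.Q + D.Kᵀ * D.R * D.K = D.P) (H : ℕ) [NeZero H] :
    ∃ C : ℝ, 0 ≤ C ∧ ∀ (S : Scenario n) (r : ℝ), S.IsBounded D r →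
      ∀ {Ω : Type*} [MeasurableSpace Ω] (s : Signals Ω n), IsClosedLoop H D S s →
      (∀ t ω, s.w t ω ∈ S.W) → (∀ t ω, s.m t ω ∈ S.M) →
      (∀ ω, MPCFeasible H D S 0 (s.xh 0 ω) (s.z 0 ω)) → ∀ T ω,
        ∑ t ∈ Finset.range T, stageCost D (s.x t ω) (s.u t ω) ≤
          C * (1 + r + ‖stochErr D S s 0 ω‖) ^ 2 +
          C * ∑ t ∈ Finset.range T, ((‖stochErr D S s t ω‖ + r + ‖s.eps (t + 1) ω‖) +
            (‖stochErr D S s t ω‖ + r + ‖s.eps (t + 1) ω‖) ^ 2) := by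
  obtain ⟨Cd, hCd, hdesc⟩ := exists_plan_descent (H := H) hs hα0 hα hU hP
  obtain ⟨Cb, hCb, hbias⟩ := exists_norm_biasSet_le (D := D) hs hα0 hα
  obtain ⟨CL, hCL, hL⟩ := exists_norm_mulVec_le D.L
  obtain ⟨CQ, hCQ, hQb, -⟩ := exists_sqNorm_le D.Q
  set a := 1 + Cb + CL * (3 + Cb) with ha
  have ha0 : 0 ≤ a := by positivity
  have m1 : 0 ≤ CL * Cb := by positivity
  set C := 8 * Cd + (2 * Cd * (a + 3 * a ^ 2) + CQ * a ^ 2) with hC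
  refine ⟨C, by positivity, fun S r hS Ω _ s hl hw hm h0 T ω => ?_⟩
  have hr := hS.nonneg
  have hopt : ∀ t, ∃ p : Plan n H, p.IsOptimal D S t (s.xh t ω) (s.z t ω) ∧ s.v t ω = p.v 0 :=
    fun t => hl.mpc t ω (hl.mpcFeasible hS.terminal (h0 ω) t)
  choose p hp hpv using hopt
  -- Up to design constants, `q t` dominates both the loop error and the innovation.
  set q : ℕ → ℝ := fun t => ‖stochErr D S s t ω‖ + r + ‖s.eps (t + 1) ω‖ with hq
  have hq0 : ∀ t, 0 ≤ q t := fun t => by positivity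
  have herr : ∀ t, ‖loopErr s t ω‖ ≤ ‖stochErr D S s t ω‖ + Cb * r := fun t => by
    have h1 := hbias S r hS t _ (hl.loopErr_sub_stochErr_mem hw hm t ω)
    calc ‖loopErr s t ω‖ = ‖stochErr D S s t ω + (loopErr s t ω - stochErr D S s t ω)‖ := by
          rw [add_sub_cancel]
      _ ≤ _ := (norm_add_le _ _).trans (by linarith)
  have herrq : ∀ t, ‖loopErr s t ω‖ ≤ (1 + Cb) * q t := fun t => by
    refine (herr t).trans ?_
    simp only [hq]
    nlinarith [mul_nonneg hCb (norm_nonneg (stochErr D S s t ω)),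
      mul_nonneg hCb (norm_nonneg (s.eps (t + 1) ω)), norm_nonneg (s.eps (t + 1) ω)]
  have hinl : ∀ t, ‖s.xh t ω - s.x t ω‖ ≤ ‖loopErr s t ω‖ := fun t => norm_inl_le (loopErr s t ω)
  have hinr : ∀ t, ‖s.x t ω - s.z t ω‖ ≤ ‖loopErr s t ω‖ := fun t => norm_inr_le (loopErr s t ω)
  have hxz : ∀ t, ‖s.xh t ω - s.z t ω‖ ≤ 2 * ‖loopErr s t ω‖ := fun t => by
    have : s.xh t ω - s.z t ω = (s.xh t ω - s.x t ω) + (s.x t ω - s.z t ω) := by abel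
    rw [this]
    linarith [norm_add_le (s.xh t ω - s.x t ω) (s.x t ω - s.z t ω), hinl t, hinr t]
  have hinn : ∀ t, ‖innovation D s t ω‖ ≤ a * q t := fun t => by
    have h1 : ‖-(s.xh t ω - s.x t ω) + s.w t ω + s.m (t + 1) ω + s.eps (t + 1) ω‖ ≤
        (3 + Cb) * q t := by
      have h2 := norm_add_le (-(s.xh t ω - s.x t ω) + s.w t ω + s.m (t + 1) ω) (s.eps (t + 1) ω)
      have h3 := norm_add_le (-(s.xh t ω - s.x t ω) + s.w t ω) (s.m (t + 1) ω)
      have h4 := norm_add_le (-(s.xh t ω - s.x t ω)) (s.w t ω)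
      rw [norm_neg] at h4
      have h5 := hS.W_le _ (hw t ω)
      have h6 := hS.M_le _ (hm (t + 1) ω)
      have h7 := herrq t
      have h8 : r + ‖s.eps (t + 1) ω‖ ≤ q t := by
        simp only [hq]; linarith [norm_nonneg (stochErr D S s t ω)]
      have h9 : r ≤ q t := by linarith [norm_nonneg (s.eps (t + 1) ω)]
      linarith [hinl t]
    refine (hL _).trans ((mul_le_mul_of_nonneg_left h1 hCL).trans ?_)
    rw [← mul_assoc]
    exact mul_le_mul_of_nonneg_right (by rw [ha]; linarith) (hq0 t)
  have hea : ∀ t, ‖loopErr s t ω‖ ≤ a * q t := fun t => (herrq t).trans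
    (mul_le_mul_of_nonneg_right (by rw [ha]; nlinarith) (hq0 t))
  -- The plan at `t + 1` is optimal, hence no worse than the shifted plan. The constant `1` in the
  -- descent error is what makes a term linear in `q` unavoidable here.
  have hstep : ∀ t, stageCost D (s.xh t ω) (s.u t ω) + (p (t + 1)).cost D ≤
      (p t).cost D + Cd * ((a + 3 * a ^ 2) * (q t + q t ^ 2)) := fun t => by
    obtain ⟨c, hc, hcost⟩ := (hdesc S r hS t _ _ (p t) (hp t).1).2 (innovation D s t ω)
    rw [hl.plan_input_eq (hp t).1 (hpv t)] at hc hcost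
    rw [← hpv t, ← hl.xh_succ, ← hl.nominal] at hc
    have h1 := (hp (t + 1)).2 c hc
    have h2 : (1 + r + ‖s.xh t ω - s.z t ω‖) * ‖innovation D s t ω‖ + ‖innovation D s t ω‖ ^ 2 ≤
        (a + 3 * a ^ 2) * (q t + q t ^ 2) := by
      have hr1 : r ≤ q t := by
        simp only [hq]
        linarith [norm_nonneg (stochErr D S s t ω), norm_nonneg (s.eps (t + 1) ω)]
      calc _ ≤ (1 + q t + 2 * (a * q t)) * (a * q t) + (a * q t) ^ 2 := by
            have := hxz t
            have := hea t
            have h3 := hinn t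
            have h4 := hq0 t
            gcongr
            linarith
        _ = (a + 3 * a ^ 2) * (q t + q t ^ 2) - 3 * a ^ 2 * q t := by ring
        _ ≤ _ := by
          have := mul_nonneg (mul_nonneg (by norm_num : (0 : ℝ) ≤ 3) (sq_nonneg a)) (hq0 t)
          linarith
    have h3 := mul_le_mul_of_nonneg_left h2 hCd
    linarith
  have htel : ∑ t ∈ Finset.range T, stageCost D (s.xh t ω) (s.u t ω) + (p T).cost D ≤
      (p 0).cost D + ∑ t ∈ Finset.range T, Cd * ((a + 3 * a ^ 2) * (q t + q t ^ 2)) := by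
    induction T with
    | zero => simp
    | succ T ih =>
      rw [Finset.sum_range_succ, Finset.sum_range_succ]
      linarith [hstep T]
  have hpT : 0 ≤ (p T).cost D := by
    refine add_nonneg ?_ (Finset.sum_nonneg fun i _ => stageCost_nonneg hQ hR _ _)
    have := sqNorm_P_nonneg hs hα0 hα hQ hR hP ((p T).xbar (Fin.last H))
    unfold terminalCost
    positivity
  have hp0 : (p 0).cost D ≤ Cd * (4 * (1 + r + ‖stochErr D S s 0 ω‖) ^ 2) := by
    refine (hdesc S r hS 0 _ _ (p 0) (hp 0).1).1.trans (mul_le_mul_of_nonneg_left ?_ hCd)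
    have h1 := hxz 0
    have h2 : loopErr s 0 ω = stochErr D S s 0 ω := by simp [loopErr, stochErr, hl.nominal_init]
    rw [h2] at h1
    have h3 := norm_nonneg (s.xh 0 ω - s.z 0 ω)
    calc _ ≤ (2 * (1 + r + ‖stochErr D S s 0 ω‖)) ^ 2 := by
          gcongr
          linarith
      _ = _ := by ring
  -- The descent concerns the cost at the estimate. Passing to the true state affects only the `Q`
  -- term, by the parallelogram bound.
  have hxc : ∀ t, stageCost D (s.x t ω) (s.u t ω) ≤
      2 * stageCost D (s.xh t ω) (s.u t ω) + CQ * a ^ 2 * (q t + q t ^ 2) := fun t => by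
    have h1 := hQ.sqNorm_add_le (s.xh t ω) (-(s.xh t ω - s.x t ω))
    rw [neg_sub, add_sub_cancel] at h1
    have h2 := hQb (s.x t ω - s.xh t ω)
    rw [norm_sub_rev] at h2
    have h3 : CQ * ‖s.xh t ω - s.x t ω‖ ^ 2 ≤ CQ * (a * q t) ^ 2 := by
      have := (hinl t).trans (hea t)
      gcongr
    have h4 := hR.sqNorm_nonneg (s.u t ω)
    have h5 : 0 ≤ CQ * a ^ 2 * q t := mul_nonneg (by positivity) (hq0 t)
    have h6 : CQ * (a * q t) ^ 2 = CQ * a ^ 2 * q t ^ 2 := by ring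
    unfold stageCost
    linarith
  have hsum := Finset.sum_le_sum fun t (_ : t ∈ Finset.range T) => hxc t
  rw [Finset.sum_add_distrib, ← Finset.mul_sum, ← Finset.mul_sum] at hsum
  rw [← Finset.mul_sum, ← Finset.mul_sum] at htel
  have hG : 0 ≤ ∑ t ∈ Finset.range T, (q t + q t ^ 2) :=
    Finset.sum_nonneg fun t _ => add_nonneg (hq0 t) (sq_nonneg _)
  have hI : 0 ≤ (1 + r + ‖stochErr D S s 0 ω‖) ^ 2 := sq_nonneg _
  set G := ∑ t ∈ Finset.range T, (q t + q t ^ 2)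
  set I := (1 + r + ‖stochErr D S s 0 ω‖) ^ 2
  calc _ ≤ 2 * (Cd * (4 * I) + Cd * ((a + 3 * a ^ 2) * G)) + CQ * a ^ 2 * G := by linarith
    _ = 8 * Cd * I + (2 * Cd * (a + 3 * a ^ 2) + CQ * a ^ 2) * G := by ring
    _ ≤ C * I + C * G := by
      refine add_le_add (mul_le_mul_of_nonneg_right ?_ hI) (mul_le_mul_of_nonneg_right ?_ hG)
      · rw [hC]; linarith [show 0 ≤ 2 * Cd * (a + 3 * a ^ 2) + CQ * a ^ 2 by positivity]
      · rw [hC]; linarith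

end ClosedLoop

/-! ### The stochastic part of the error -/

section StochasticError

variable {n : ℕ} {Ω : Type*} [mΩ : MeasurableSpace Ω] {ℙ : Measure Ω}
  {𝓕 : Filtration ℕ mΩ} {D : Design n} {S : Scenario n} {s : Signals Ω n}

lemma measurable_mulVec {Ω' ι κ : Type*} [Fintype κ] {𝓖 : MeasurableSpace Ω'} (M : Matrix ι κ ℝ)
    {f : Ω' → κ → ℝ} (hf : Measurable f) : Measurable fun ω => M *ᵥ f ω := by
  unfold Matrix.mulVec dotProduct
  fun_prop

lemma measurable_elim_sub {Ω' : Type*} {𝓖 : MeasurableSpace Ω'} {f g : Ω' → Vec n}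
    (hf : Measurable f) (hg : Measurable g) (c : Vec n) :
    Measurable fun ω => (Sum.elim (f ω - g ω) (g ω - c) : Vec2 n) := by
  refine measurable_pi_lambda _ fun i => ?_
  rcases i with i | i
  · exact (measurable_pi_iff.1 hf i).sub (measurable_pi_iff.1 hg i)
  · exact (measurable_pi_iff.1 hg i).sub_const _

lemma NoiseModel.measurable_stochErr (hn : NoiseModel ℙ 𝓕 S s) (t : ℕ) :
    Measurable[𝓕 t] (stochErr D S s t) := by
  induction t with
  | zero =>
    exact measurable_elim_sub (𝓖 := 𝓕 0) hn.xh0_meas hn.x0_meas S.mu0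
  | succ t ih =>
    exact (measurable_mulVec (𝓖 := 𝓕 (t + 1)) _ (ih.mono (𝓕.mono t.le_succ) le_rfl)).add
      (measurable_mulVec (𝓖 := 𝓕 (t + 1)) _ (hn.eps_meas (t + 1)))

lemma NoiseModel.hasSubGaussianBound_stochErr [IsProbabilityMeasure ℙ] (hn : NoiseModel ℙ 𝓕 S s) (t : ℕ) :
    HasSubGaussianBound ℙ (stochErr D S s t) (errProxy D S t) := by
  induction t with
  | zero => exact hn.init_subGaussian.hasSubGaussianBound
  | succ t ih =>
    exact ih.add_condSubGaussian (𝓕.le t) (hn.measurable_stochErr t)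
      ((hn.eps_meas (t + 1)).mono (𝓕.le _) le_rfl) (hn.eps_subGaussian t) (Ae D) (B2 D)

/-- The variance recursion unrolled on a test vector. Keeping `Aeᵀ ^ t` next to `sigma0` preserves
the decay of the initial uncertainty. -/
lemma sqNorm_errProxy_le [NeZero n] (hS : S.Seps.PosDef) (t : ℕ) (l : Vec2 n) :
    sqNorm (errProxy D S t) l ≤ 2 * n * S.sigma0 ^ 2 * ‖((Ae D)ᵀ ^ t) *ᵥ l‖ ^ 2 +
      n ^ 2 * maxEigenvalue S.Seps *
        ∑ j ∈ Finset.range t, ‖(B2 D)ᵀ *ᵥ ((Ae D)ᵀ ^ j) *ᵥ l‖ ^ 2 := by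
  induction t generalizing l with
  | zero =>
    have h := dotProduct_self_le l
    rw [Fintype.card_sum, Fintype.card_fin] at h
    have h1 : sqNorm (errProxy D S 0) l = S.sigma0 ^ 2 * (l ⬝ᵥ l) := by
      simp [errProxy, sqNorm, Matrix.smul_mulVec]
    rw [h1]
    simp only [pow_zero, Matrix.one_mulVec, Finset.range_zero, Finset.sum_empty, mul_zero, add_zero]
    push_cast at h
    nlinarith [mul_le_mul_of_nonneg_left h (sq_nonneg S.sigma0)]
  | succ t ih =>
    have h1 := ih ((Ae D)ᵀ *ᵥ l)
    have h2 := sqNorm_le_maxEigenvalue hS ((B2 D)ᵀ *ᵥ l)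
    rw [errProxy, sqNorm_add_matrix, sqNorm_conj, sqNorm_conj, Finset.sum_range_succ']
    have hpow : ∀ j, ((Ae D)ᵀ ^ j) *ᵥ (Ae D)ᵀ *ᵥ l = ((Ae D)ᵀ ^ (j + 1)) *ᵥ l := fun j => by
      rw [Matrix.mulVec_mulVec, ← pow_succ]
    simp only [hpow] at h1
    simp only [pow_zero, Matrix.one_mulVec]
    linarith

lemma NoiseModel.exists_second_moment_bounds [NeZero n] {α : ℕ → ℝ} (hs : Summable α)
    (hα0 : ∀ j, 0 ≤ α j) (hα : ∀ j x, ‖((Ae D)ᵀ ^ j) *ᵥ x‖ ≤ α j * ‖x‖) :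
    ∃ C : ℝ, 0 ≤ C ∧ ∀ (S : Scenario n), S.Seps.PosDef →
      ∀ {Ω : Type*} [mΩ : MeasurableSpace Ω] (ℙ : Measure Ω) [IsProbabilityMeasure ℙ]
        (𝓕 : Filtration ℕ mΩ) (s : Signals Ω n), NoiseModel ℙ 𝓕 S s → ∀ t,
        ∫⁻ ω, ENNReal.ofReal (‖stochErr D S s t ω‖ ^ 2) ∂ℙ ≤
          ENNReal.ofReal (C * (S.sigma0 ^ 2 * α t + maxEigenvalue S.Seps)) ∧
        ∫⁻ ω, ENNReal.ofReal (‖s.eps (t + 1) ω‖ ^ 2) ∂ℙ ≤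
          ENNReal.ofReal (C * maxEigenvalue S.Seps) := by
  obtain ⟨CB, hCB, hB⟩ := exists_norm_mulVec_le (B2 D)ᵀ
  set Γ := ∑' j, α j
  have hΓ : 0 ≤ Γ := tsum_nonneg hα0
  have hαΓ : ∀ j, α j ≤ Γ := fun j => hs.le_tsum j fun i _ => hα0 i
  have hn0 : (0 : ℝ) < n := by exact_mod_cast Nat.pos_of_ne_zero (NeZero.ne n)
  set C₁ : ℝ := 2 * n * Γ + n ^ 2 * CB ^ 2 * Γ ^ 2 + n ^ 2 with hC₁
  have hC₁0 : 0 < C₁ := by positivity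
  refine ⟨4 * n * C₁, by positivity, fun S hS Ω mΩ ℙ _ 𝓕 s hn t => ?_⟩
  have hσ := (maxEigenvalue_bounds hS).1
  set σ := maxEigenvalue S.Seps
  constructor
  · have hτ : 0 < C₁ * (S.sigma0 ^ 2 * α t + σ) := by
      have := hα0 t
      positivity
    refine ((hn.hasSubGaussianBound_stochErr t).lintegral_norm_sq_le
      ((hn.measurable_stochErr t).mono (𝓕.le t) le_rfl) hτ fun l hl => ?_).trans
      (ENNReal.ofReal_le_ofReal (le_of_eq ?_))
    · have hAl : ∀ j, ‖((Ae D)ᵀ ^ j) *ᵥ l‖ ≤ α j := fun j =>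
        (hα j l).trans (mul_le_of_le_one_right (hα0 j) hl)
      -- Only one of the two factors is bounded by the total `Γ`; the remaining `α t` keeps the
      -- transient summable in time.
      have h1 : ‖((Ae D)ᵀ ^ t) *ᵥ l‖ ^ 2 ≤ Γ * α t := by
        rw [sq]
        exact mul_le_mul ((hAl t).trans (hαΓ t)) (hAl t) (norm_nonneg _) hΓ
      have h2 : ∑ j ∈ Finset.range t, ‖(B2 D)ᵀ *ᵥ ((Ae D)ᵀ ^ j) *ᵥ l‖ ^ 2 ≤ CB ^ 2 * Γ ^ 2 := by
        calc _ ≤ ∑ j ∈ Finset.range t, CB ^ 2 * Γ * α j := Finset.sum_le_sum fun j _ => by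
              calc ‖(B2 D)ᵀ *ᵥ ((Ae D)ᵀ ^ j) *ᵥ l‖ ^ 2 ≤ (CB * α j) ^ 2 := by
                    have := (hB (((Ae D)ᵀ ^ j) *ᵥ l)).trans (mul_le_mul_of_nonneg_left (hAl j) hCB)
                    gcongr
                _ = CB ^ 2 * (α j * α j) := by ring
                _ ≤ CB ^ 2 * (Γ * α j) := by
                    have := hα0 j
                    have := hαΓ j
                    gcongr
                _ = _ := by ring
          _ = CB ^ 2 * Γ * ∑ j ∈ Finset.range t, α j := (Finset.mul_sum _ _ _).symm
          _ ≤ CB ^ 2 * Γ * Γ := mul_le_mul_of_nonneg_left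
              (hs.sum_le_tsum _ fun j _ => hα0 j) (by positivity)
          _ = _ := by ring
      have h3 := mul_le_mul_of_nonneg_left h1 (show 0 ≤ 2 * n * S.sigma0 ^ 2 by positivity)
      have h4 := mul_le_mul_of_nonneg_left h2 (show 0 ≤ n ^ 2 * σ by positivity)
      refine (sqNorm_errProxy_le hS t l).trans ((add_le_add h3 h4).trans ?_)
      have := hα0 t
      rw [← sub_nonneg]
      have e : C₁ * (S.sigma0 ^ 2 * α t + σ) -
          (2 * n * S.sigma0 ^ 2 * (Γ * α t) + n ^ 2 * σ * (CB ^ 2 * Γ ^ 2)) =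
          (n ^ 2 * CB ^ 2 * Γ ^ 2 + n ^ 2) * (S.sigma0 ^ 2 * α t) + (2 * n * Γ + n ^ 2) * σ := by
        rw [hC₁]; ring
      rw [e]
      positivity
    · rw [Fintype.card_sum, Fintype.card_fin]
      push_cast
      ring
  · have hτ : 0 < n ^ 2 * σ := by positivity
    have hm := (hn.eps_meas (t + 1)).mono (𝓕.le _) le_rfl
    refine (((hn.eps_subGaussian t).hasSubGaussianBound (𝓕.le t) hm).lintegral_norm_sq_le
      hm hτ fun l hl => ?_).trans (ENNReal.ofReal_le_ofReal ?_)
    · refine (sqNorm_le_maxEigenvalue hS l).trans ?_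
      exact mul_le_of_le_one_right hτ.le (pow_le_one₀ (norm_nonneg _) hl)
    · rw [Fintype.card_fin]
      have h1 : (n : ℝ) ^ 2 ≤ C₁ := by
        rw [hC₁]; linarith [show 0 ≤ 2 * n * Γ + n ^ 2 * CB ^ 2 * Γ ^ 2 by positivity]
      have h2 : 2 * (n : ℝ) * (n ^ 2 * σ) ≤ 2 * n * (C₁ * σ) := by gcongr
      have h3 : 0 ≤ n * (C₁ * σ) := by positivity
      linarith

end StochasticError

/-! ### Positive definiteness of the variance proxies and chance constraints -/

section ChanceConstraints

variable {n H : ℕ} {D : Design n} {S : Scenario n}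

/-- If `Lᵀ v = 0`, then `[v; 0]` is fixed by `Aeᵀ`, against the decay of its powers. -/
lemma isUnit_det_L {α : ℕ → ℝ} (hs : Summable α)
    (hα : ∀ j x, ‖((Ae D)ᵀ ^ j) *ᵥ x‖ ≤ α j * ‖x‖) : IsUnit D.L.det := by
  rw [isUnit_iff_ne_zero, ← Matrix.det_transpose]
  intro h0
  obtain ⟨v, hv, hLv⟩ := Matrix.exists_mulVec_eq_zero_iff.2 h0
  set e : Vec2 n := Sum.elim v 0 with he
  have hfix1 : (Ae D)ᵀ *ᵥ e = e := by
    rw [he, Ae, Matrix.fromBlocks_transpose, Matrix.fromBlocks_mulVec]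
    simp [Matrix.sub_mulVec, hLv]
  have hfix : ∀ j : ℕ, ((Ae D)ᵀ ^ j) *ᵥ e = e := fun j => by
    induction j with
    | zero => simp
    | succ j ih => rw [pow_succ, ← Matrix.mulVec_mulVec, hfix1, ih]
  have hle : ∀ j, ‖e‖ ≤ α j * ‖e‖ := fun j => by simpa [hfix j] using hα j e
  have hlim := (hs.tendsto_atTop_zero.mul_const ‖e‖)
  rw [zero_mul] at hlim
  have h1 := norm_le_zero_iff.1 (ge_of_tendsto' hlim hle)
  exact hv (funext fun i => congrFun h1 (Sum.inl i))

lemma eq_zero_of_transpose_mulVec_eq_zero {M : Mat n} (hM : IsUnit M.det) {x : Vec n}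
    (h : Mᵀ *ᵥ x = 0) : x = 0 := by
  refine Matrix.eq_zero_of_mulVec_eq_zero ?_ h
  rw [Matrix.det_transpose]
  exact hM.ne_zero

/-- The kernels of `Aeᵀ` and `B2ᵀ` meet only at zero: `Lᵀ a = 0` gives `a = 0`, and the upper block
of `Aeᵀ` then reads `Kᵀ b = 0`. Invertibility of `Ae` itself is not needed. -/
lemma posDef_errProxy (hK : IsUnit D.K.det) (hL : IsUnit D.L.det) (hS : S.Seps.PosDef)
    (h0 : 0 < S.sigma0) (t : ℕ) : (errProxy D S t).PosDef := by
  induction t with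
  | zero => exact Matrix.PosDef.one.smul (pow_pos h0 2)
  | succ t ih =>
    have hA := ih.posSemidef.mul_mul_conjTranspose_same (Ae D)
    have hB := hS.posSemidef.mul_mul_conjTranspose_same (B2 D)
    rw [Matrix.conjTranspose_eq_transpose_of_trivial] at hA hB
    refine Matrix.PosDef.of_dotProduct_mulVec_pos (hA.add hB).1 fun x hx => ?_
    have h1 := ih.posSemidef.sqNorm_nonneg ((Ae D)ᵀ *ᵥ x)
    have h2 := hS.posSemidef.sqNorm_nonneg ((B2 D)ᵀ *ᵥ x)
    have hgoal : star x ⬝ᵥ errProxy D S (t + 1) *ᵥ x =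
        sqNorm (errProxy D S t) ((Ae D)ᵀ *ᵥ x) + sqNorm S.Seps ((B2 D)ᵀ *ᵥ x) := by
      rw [← sqNorm_conj, ← sqNorm_conj, ← sqNorm_add_matrix]
      simp [sqNorm, errProxy]
    rw [hgoal]
    by_contra hle
    have hAx : (Ae D)ᵀ *ᵥ x = 0 := by
      by_contra hne
      have := ih.dotProduct_mulVec_pos hne
      simp only [star_trivial] at this
      exact hle (add_pos_of_pos_of_nonneg this h2)
    have hBx : (B2 D)ᵀ *ᵥ x = 0 := by
      by_contra hne
      have := hS.dotProduct_mulVec_pos hne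
      simp only [star_trivial] at this
      exact hle (add_pos_of_nonneg_of_pos h1 this)
    obtain ⟨a, b, rfl⟩ : ∃ a b : Vec n, x = Sum.elim a b :=
      ⟨x ∘ Sum.inl, x ∘ Sum.inr, (Sum.elim_comp_inl_inr x).symm⟩
    have ha : a = 0 := by
      refine eq_zero_of_transpose_mulVec_eq_zero hL ?_
      rw [B2, Matrix.transpose_fromRows, Matrix.fromCols_mulVec] at hBx
      simpa using hBx
    have hb : b = 0 := by
      refine eq_zero_of_transpose_mulVec_eq_zero hK ?_
      rw [Ae, Matrix.fromBlocks_transpose, Matrix.fromBlocks_mulVec] at hAx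
      funext i
      simpa [ha] using congrFun hAx (Sum.inl i)
    exact hx (by rw [ha, hb]; ext i; rcases i with i | i <;> rfl)

lemma posDef_Ke_conj (hK : IsUnit D.K.det) {V : Mat2 n} (hV : V.PosDef) :
    (Ke D * V * (Ke D)ᵀ).PosDef := by
  have hA := hV.posSemidef.mul_mul_conjTranspose_same (Ke D)
  rw [Matrix.conjTranspose_eq_transpose_of_trivial] at hA
  refine Matrix.PosDef.of_dotProduct_mulVec_pos hA.1 fun x hx => ?_
  have hne : (Ke D)ᵀ *ᵥ x ≠ 0 := by
    intro h
    obtain ⟨a, b, rfl⟩ : ∃ a b : Vec n, x = Sum.elim a b :=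
      ⟨x ∘ Sum.inl, x ∘ Sum.inr, (Sum.elim_comp_inl_inr x).symm⟩
    rw [Ke, Matrix.fromBlocks_transpose, Matrix.fromBlocks_mulVec] at h
    have hb : b = 0 := by
      refine eq_zero_of_transpose_mulVec_eq_zero hK ?_
      funext i
      simpa using congrFun h (Sum.inl i)
    have ha : a = 0 := by
      funext i
      simpa [hb] using congrFun h (Sum.inr i)
    exact hx (by rw [ha, hb]; ext i; rcases i with i | i <;> rfl)
  have := hV.dotProduct_mulVec_pos hne
  simp only [star_trivial] at this ⊢
  exact this.trans_eq (sqNorm_conj (Ke D) V x).symm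

/-- Satisfaction of the chance constraints from feasibility. -/
lemma IsClosedLoop.chance_constraint [NeZero n] [NeZero H] {Ω : Type*} [mΩ : MeasurableSpace Ω]
    {ℙ : Measure Ω} [IsProbabilityMeasure ℙ] {𝓕 : Filtration ℕ mΩ} {s : Signals Ω n}
    (hl : IsClosedLoop H D S s) (hn : NoiseModel ℙ 𝓕 S s) (hK : IsUnit D.K.det)
    (hL : IsUnit D.L.det) (hS : S.Seps.PosDef) (h0 : 0 < S.sigma0) (hδ : 0 < S.delta)
    (hδ1 : S.delta < 1) {t : ℕ} (hfeas : ∀ ω, MPCFeasible H D S t (s.xh t ω) (s.z t ω)) :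
    ENNReal.ofReal (1 - S.delta) ≤
      ℙ {ω | Sum.elim (s.x t ω) (s.u t ω) ∈ stackSet S.X D.U} := by
  set good := {ω | Ke D *ᵥ stochErr D S s t ω ∈ confSet D S t} with hgood
  have hsub : good ⊆ {ω | Sum.elim (s.x t ω) (s.u t ω) ∈ stackSet S.X D.U} := fun ω hω => by
    obtain ⟨p, hp, hv⟩ := hl.mpc t ω (hfeas ω)
    have h1 := hp.1.cons 0
    rw [Fin.castSucc_zero', hp.1.z_init, ← hv] at h1
    have h2 : Ke D *ᵥ loopErr s t ω ∈ errSet D S t := by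
      have h3 := Set.add_mem_add (show Ke D *ᵥ stochErr D S s t ω ∈ confSet D S t from hω)
        (Set.mem_image_of_mem (fun e => Ke D *ᵥ e)
          (hl.loopErr_sub_stochErr_mem hn.w_mem hn.m_mem t ω))
      rwa [← Matrix.mulVec_add, add_sub_cancel] at h3
    have h4 := h1 _ h2
    rwa [← hl.sub_eq_Ke_mulVec] at h4
  have hbad : ℙ goodᶜ ≤ ENNReal.ofReal S.delta := by
    obtain ⟨ha, hlevel⟩ := kapInv_level (n := n) hδ hδ1
    have hm : Measurable fun ω => Ke D *ᵥ stochErr D S s t ω :=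
      measurable_mulVec _ ((hn.measurable_stochErr t).mono (𝓕.le t) le_rfl)
    have h1 := ((hn.hasSubGaussianBound_stochErr (D := D) t).mulVec (Ke D)).measure_lt_sqNorm_inv
      (posDef_Ke_conj hK (posDef_errProxy hK hL hS h0 t)) hm ha
    rw [Fintype.card_sum, Fintype.card_fin, ← two_mul, hlevel] at h1
    refine (measure_mono fun ω hω => ?_).trans h1
    simp only [hgood, confSet, Set.mem_compl_iff, Set.mem_ofPred_eq, not_le] at hω
    simp only [Set.mem_ofPred_eq]
    push_cast
    linarith
  -- Subadditivity is enough, so no measurability of the events is required.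
  have h1 : 1 ≤ ℙ good + ℙ goodᶜ := by
    rw [← measure_univ (μ := ℙ), ← Set.union_compl_self good]
    exact measure_union_le _ _
  rw [ENNReal.ofReal_sub _ hδ.le, ENNReal.ofReal_one, tsub_le_iff_right]
  exact h1.trans (add_le_add (measure_mono hsub) hbad)

end ChanceConstraints

/-! ### Average cost -/

section MeanBounds

variable {Ω : Type*} [MeasurableSpace Ω] {ℙ : Measure Ω}

/-- `f` is integrable with mean at most `a`. -/
def MeanLE (ℙ : Measure Ω) (f : Ω → ℝ) (a : ℝ) : Prop := Integrable f ℙ ∧ ∫ ω, f ω ∂ℙ ≤ a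

lemma MeanLE.of_lintegral {f : Ω → ℝ} {a : ℝ} (hf : Measurable f) (h0 : ∀ ω, 0 ≤ f ω)
    (ha : 0 ≤ a) (h : ∫⁻ ω, ENNReal.ofReal (f ω) ∂ℙ ≤ ENNReal.ofReal a) : MeanLE ℙ f a := by
  have hi : Integrable f ℙ :=
    (lintegral_ofReal_ne_top_iff_integrable hf.aestronglyMeasurable (Eventually.of_forall h0)).1
      (h.trans_lt ENNReal.ofReal_lt_top).ne
  refine ⟨hi, ?_⟩
  rwa [← ofReal_integral_eq_lintegral_ofReal hi (Eventually.of_forall h0),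
    ENNReal.ofReal_le_ofReal_iff ha] at h

lemma MeanLE.const [IsProbabilityMeasure ℙ] (c : ℝ) : MeanLE ℙ (fun _ => c) c :=
  ⟨integrable_const c, by simp⟩

lemma MeanLE.add {f g : Ω → ℝ} {a b : ℝ} (hf : MeanLE ℙ f a) (hg : MeanLE ℙ g b) :
    MeanLE ℙ (fun ω => f ω + g ω) (a + b) :=
  ⟨hf.1.add hg.1, by rw [integral_add hf.1 hg.1]; exact add_le_add hf.2 hg.2⟩

lemma MeanLE.const_mul {f : Ω → ℝ} {a c : ℝ} (hf : MeanLE ℙ f a) (hc : 0 ≤ c) :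
    MeanLE ℙ (fun ω => c * f ω) (c * a) :=
  ⟨hf.1.const_mul c, by rw [integral_const_mul]; exact mul_le_mul_of_nonneg_left hf.2 hc⟩

lemma MeanLE.sum {ι : Type*} (I : Finset ι) {f : ι → Ω → ℝ} {a : ι → ℝ}
    (hf : ∀ i, MeanLE ℙ (f i) (a i)) : MeanLE ℙ (fun ω => ∑ i ∈ I, f i ω) (∑ i ∈ I, a i) :=
  ⟨integrable_finsetSum _ fun i _ => (hf i).1, by
    rw [integral_finsetSum _ fun i _ => (hf i).1]
    exact Finset.sum_le_sum fun i _ => (hf i).2⟩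

lemma MeanLE.lintegral_le {f g : Ω → ℝ} {a : ℝ} (hf : MeanLE ℙ f a) (hg0 : ∀ ω, 0 ≤ g ω)
    (hgf : ∀ ω, g ω ≤ f ω) : ∫⁻ ω, ENNReal.ofReal (g ω) ∂ℙ ≤ ENNReal.ofReal a := by
  refine (lintegral_mono fun ω => ENNReal.ofReal_le_ofReal (hgf ω)).trans ?_
  rw [← ofReal_integral_eq_lintegral_ofReal hf.1
    (Eventually.of_forall fun ω => (hg0 ω).trans (hgf ω))]
  exact ENNReal.ofReal_le_ofReal hf.2

/-- The lower integral is superadditive without measurability, and only this direction is needed for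
an upper bound on the cost. -/
lemma sum_lintegral_ofReal_le {f : ℕ → Ω → ℝ} (hf : ∀ t ω, 0 ≤ f t ω) (T : ℕ) :
    ∑ t ∈ Finset.range T, ∫⁻ ω, ENNReal.ofReal (f t ω) ∂ℙ ≤
      ∫⁻ ω, ENNReal.ofReal (∑ t ∈ Finset.range T, f t ω) ∂ℙ := by
  induction T with
  | zero => simp
  | succ T ih =>
    rw [Finset.sum_range_succ]
    refine (add_le_add_left ih _).trans ((le_lintegral_add _ _).trans (le_of_eq ?_))
    refine lintegral_congr fun ω => ?_
    rw [← ENNReal.ofReal_add (Finset.sum_nonneg fun t _ => hf t ω) (hf T ω), Finset.sum_range_succ]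

lemma limsup_average_le {c : ℕ → ℝ≥0∞} {E G : ℝ}
    (h : ∀ T : ℕ, ∑ t ∈ Finset.range T, c t ≤ ENNReal.ofReal (E + T * G)) :
    limsup (fun T : ℕ => (T : ℝ≥0∞)⁻¹ * ∑ t ∈ Finset.range T, c t) atTop ≤ ENNReal.ofReal G := by
  have hlim : Tendsto (fun T : ℕ => ENNReal.ofReal (E / T + G)) atTop (nhds (ENNReal.ofReal G)) := by
    refine (ENNReal.continuous_ofReal.tendsto G).comp ?_
    simpa using (tendsto_const_div_atTop_nhds_zero_nat E).add_const G
  rw [← hlim.limsup_eq]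
  refine limsup_le_limsup ?_
  filter_upwards [eventually_gt_atTop 0] with T hT
  have hT' : (0 : ℝ) < T := by exact_mod_cast hT
  calc (T : ℝ≥0∞)⁻¹ * ∑ t ∈ Finset.range T, c t
      ≤ ENNReal.ofReal (T : ℝ)⁻¹ * ENNReal.ofReal (E + T * G) := by
        rw [ENNReal.ofReal_inv_of_pos hT', ENNReal.ofReal_natCast]
        exact mul_le_mul_right (h T) _
    _ = _ := by
        rw [← ENNReal.ofReal_mul (by positivity)]
        congr 1
        field_simp

end MeanBounds

/-- The linear term supplies strict monotonicity and unboundedness, so `f` need only be monotone. -/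
lemma isKInfty_mul_add {C : ℝ≥0} (hC : 0 < C) {f : ℝ≥0 → ℝ≥0} (hf : Continuous f)
    (hmono : Monotone f) (h0 : f 0 = 0) : IsKInfty fun r => C * (r + f r) where
  continuous := by fun_prop
  strictMono := fun a b hab =>
    mul_lt_mul_of_pos_left (add_lt_add_of_lt_of_le hab (hmono hab.le)) hC
  unbounded := fun b => ⟨C⁻¹ * (b + 1), by
    have h1 : b < b + 1 := lt_add_of_pos_right b one_pos
    rw [mul_add, mul_inv_cancel_left₀ hC.ne']
    exact h1.trans_le le_self_add⟩
  zero := by simp [h0]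

/-- Trades the linear term for a constant `θ` plus `q² / θ`. When `q²` has mean of order `θ²`, both
are of order `θ`. -/
lemma add_sq_le_of_pos {q s r ε θ : ℝ} (hθ : 0 < θ) (hq : q = s + r + ε) :
    q + q ^ 2 ≤ θ + 3 * (θ⁻¹ + 1) * (s ^ 2 + (r ^ 2 + ε ^ 2)) := by
  have h1 : q ≤ θ + θ⁻¹ * q ^ 2 := by
    have h2 : 0 ≤ θ⁻¹ * ((q - θ) ^ 2 + q * θ) ∨ q < 0 := by
      rcases lt_or_ge q 0 with h | h
      · exact Or.inr h
      · exact Or.inl (by positivity)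
    rcases h2 with h2 | h2
    · have : θ⁻¹ * ((q - θ) ^ 2 + q * θ) = θ + θ⁻¹ * q ^ 2 - q := by field_simp; ring
      linarith
    · have : 0 ≤ θ⁻¹ * q ^ 2 := by positivity
      linarith
  have h3 : q ^ 2 ≤ 3 * (s ^ 2 + (r ^ 2 + ε ^ 2)) := by
    rw [hq]; nlinarith [sq_nonneg (s - r), sq_nonneg (s - ε), sq_nonneg (r - ε)]
  have h4 := mul_le_mul_of_nonneg_left h3 (by positivity : 0 ≤ θ⁻¹ + 1)
  linarith

/-- Average cost of the closed loop in terms of `θ = r + √σ`. -/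
lemma exists_limsup_average_le {n : ℕ} [NeZero n] {D : Design n} {α : ℕ → ℝ} (hs : Summable α)
    (hα0 : ∀ j, 0 ≤ α j) (hα : ∀ j x, ‖(Ae D ^ j) *ᵥ x‖ ≤ α j * ‖x‖)
    (hα' : ∀ j x, ‖((Ae D)ᵀ ^ j) *ᵥ x‖ ≤ α j * ‖x‖)
    (hU : Bornology.IsBounded D.U) (hQ : D.Q.PosSemidef) (hR : D.R.PosSemidef)
    (hP : (1 + D.K)ᵀ * D.P * (1 + D.K) + D.Q + D.Kᵀ * D.R * D.K = D.P) (H : ℕ) [NeZero H] :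
    ∃ C : ℝ, 0 < C ∧ ∀ (S : Scenario n) (r : ℝ), S.IsBounded D r → S.Seps.PosDef →
      ∀ {Ω : Type*} [mΩ : MeasurableSpace Ω] (ℙ : Measure Ω) [IsProbabilityMeasure ℙ]
        (𝓕 : Filtration ℕ mΩ) (s : Signals Ω n), NoiseModel ℙ 𝓕 S s → IsClosedLoop H D S s →
      (∀ ω, MPCFeasible H D S 0 (s.xh 0 ω) (s.z 0 ω)) →
      limsup (fun T : ℕ => (T : ℝ≥0∞)⁻¹ * ∑ t ∈ Finset.range T,
            ∫⁻ ω, ENNReal.ofReal (stageCost D (s.x t ω) (s.u t ω)) ∂ℙ) atTop ≤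
        ENNReal.ofReal (C * (r + √(maxEigenvalue S.Seps) + (r + √(maxEigenvalue S.Seps)) ^ 2)) := by
  obtain ⟨C, hC, hpath⟩ := exists_sum_stageCost_le hs hα0 hα hU hQ hR hP H
  obtain ⟨M, hM, hmom⟩ := NoiseModel.exists_second_moment_bounds hs hα0 hα'
  refine ⟨C + 3 * C * (2 * M + 1) + 1, by positivity,
    fun S r hS hSeps Ω mΩ ℙ _ 𝓕 s hn hl h0 => ?_⟩
  have hr := hS.nonneg
  have hσ := (maxEigenvalue_bounds hSeps).1
  have hmom' := hmom S hSeps ℙ 𝓕 s hn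
  have hcost := hpath S r hS s hl hn.w_mem hn.m_mem h0
  set σ := maxEigenvalue S.Seps
  have hσ' : 0 < √σ := Real.sqrt_pos.2 hσ
  set θ := r + √σ with hθ
  have hθ0 : 0 < θ := by positivity
  set Γ := ∑' j, α j
  set B := 3 * C * (θ⁻¹ + 1) with hB
  have hB0 : 0 ≤ B := by positivity
  have hσ2 : √σ ^ 2 = σ := Real.sq_sqrt hσ.le
  have hms : ∀ t, MeanLE ℙ (fun ω => ‖stochErr D S s t ω‖ ^ 2) (M * (S.sigma0 ^ 2 * α t + σ)) :=
    fun t => MeanLE.of_lintegral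
      (((hn.measurable_stochErr t).mono (𝓕.le t) le_rfl).norm.pow_const 2) (fun ω => sq_nonneg _)
      (by have := hα0 t; positivity) (hmom' t).1
  have hme : ∀ t, MeanLE ℙ (fun ω => ‖s.eps (t + 1) ω‖ ^ 2) (M * σ) :=
    fun t => MeanLE.of_lintegral
      (((hn.eps_meas (t + 1)).mono (𝓕.le _) le_rfl).norm.pow_const 2) (fun ω => sq_nonneg _)
      (by positivity) (hmom' t).2
  -- `E` collects what stays bounded in `T`: the initial cost and the summed transient. `G` is the
  -- cost per step.
  refine (limsup_average_le (E := 2 * C * (1 + r) ^ 2 + 2 * C * (M * (S.sigma0 ^ 2 * α 0 + σ)) +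
    B * M * S.sigma0 ^ 2 * Γ) (G := C * θ + B * (2 * (M * σ) + r ^ 2)) fun T => ?_).trans
    (ENNReal.ofReal_le_ofReal ?_)
  · refine (sum_lintegral_ofReal_le (fun t ω => stageCost_nonneg hQ hR _ _) T).trans ?_
    have hmean := ((MeanLE.const (ℙ := ℙ) (2 * C * (1 + r) ^ 2)).add
      ((hms 0).const_mul (by positivity : 0 ≤ 2 * C))).add
      (MeanLE.sum (Finset.range T) fun t => (MeanLE.const (ℙ := ℙ) (C * θ)).add
        (((hms t).add ((MeanLE.const (r ^ 2)).add (hme t))).const_mul hB0))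
    refine (hmean.lintegral_le
      (fun ω => Finset.sum_nonneg fun t _ => stageCost_nonneg hQ hR _ _) fun ω => ?_).trans
      (ENNReal.ofReal_le_ofReal ?_)
    · refine (hcost T ω).trans (add_le_add ?_ ?_)
      · have : (1 + r + ‖stochErr D S s 0 ω‖) ^ 2 ≤
            2 * (1 + r) ^ 2 + 2 * ‖stochErr D S s 0 ω‖ ^ 2 := by
          nlinarith [sq_nonneg (1 + r - ‖stochErr D S s 0 ω‖)]
        have := mul_le_mul_of_nonneg_left this hC
        linarith
      · rw [Finset.mul_sum]
        refine Finset.sum_le_sum fun t _ => ?_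
        have := mul_le_mul_of_nonneg_left (add_sq_le_of_pos hθ0
          (rfl : ‖stochErr D S s t ω‖ + r + ‖s.eps (t + 1) ω‖ = _)) hC
        rw [hB]
        linarith
    · have hsum : ∑ t ∈ Finset.range T,
          (C * θ + B * (M * (S.sigma0 ^ 2 * α t + σ) + (r ^ 2 + M * σ))) =
          B * M * S.sigma0 ^ 2 * ∑ t ∈ Finset.range T, α t +
            T * (C * θ + B * (2 * (M * σ) + r ^ 2)) := by
        rw [Finset.mul_sum, ← nsmul_eq_mul, ← Finset.card_range T, ← Finset.sum_const,
          Finset.card_range, ← Finset.sum_add_distrib]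
        exact Finset.sum_congr rfl fun t _ => by ring
      rw [hsum]
      have := mul_le_mul_of_nonneg_left (hs.sum_le_tsum (Finset.range T) fun j _ => hα0 j)
        (by positivity : 0 ≤ B * M * S.sigma0 ^ 2)
      linarith
  · have h1 : r ^ 2 ≤ θ ^ 2 := by
      have : r ≤ θ := by rw [hθ]; linarith
      gcongr
    have h2 : σ ≤ θ ^ 2 := by
      rw [← hσ2]
      have : √σ ≤ θ := by rw [hθ]; linarith
      gcongr
    have h3 : B * (2 * (M * σ) + r ^ 2) ≤ B * ((2 * M + 1) * θ ^ 2) := by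
      refine mul_le_mul_of_nonneg_left ?_ hB0
      nlinarith
    have h4 : B * ((2 * M + 1) * θ ^ 2) = 3 * C * (2 * M + 1) * (θ + θ ^ 2) := by
      rw [hB]; field_simp
    have h5 : 0 ≤ C * θ ^ 2 := by positivity
    rw [h4] at h3
    nlinarith [sq_nonneg θ]

end BiasedSubGaussianMPC

/-! ### The closed-loop theorem. -/

theorem theorem1 {n H : ℕ} [NeZero n] [NeZero H] (D : BiasedSubGaussianMPC.Design n)
    (hQ : D.Q.PosSemidef) (hR : D.R.PosSemidef)
    (hP : (1 + D.K)ᵀ * D.P * (1 + D.K) + D.Q + D.Kᵀ * D.R * D.K = D.P)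
    (hSchur : BiasedSubGaussianMPC.SchurStable (BiasedSubGaussianMPC.Ae D))
    (hU : Bornology.IsBounded D.U) (hUm : MeasurableSet D.U) :
    ∃ κw κε : ℝ≥0 → ℝ≥0,
      BiasedSubGaussianMPC.IsKInfty κw ∧ BiasedSubGaussianMPC.IsKInfty κε ∧
      ∀ (S : BiasedSubGaussianMPC.Scenario n) (rw rm : ℝ≥0)
        (_hX : MeasurableSet S.X)
        (_hW : ∀ w ∈ S.W, ‖WithLp.toLp 2 w‖ ≤ rw)
        (_hM : ∀ m ∈ S.M, ‖WithLp.toLp 2 m‖ ≤ rm)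
        (_hSeps : S.Seps.PosDef) (_hsigma0 : 0 < S.sigma0)
        (_hdelta : 0 < S.delta ∧ S.delta < 1)
        (_hterm : BiasedSubGaussianMPC.TerminalAssumption D S)
        {Ω : Type*} [mΩ : MeasurableSpace Ω] (ℙ : Measure Ω) [IsProbabilityMeasure ℙ]
        (𝓕 : Filtration ℕ mΩ) (s : BiasedSubGaussianMPC.Signals Ω n)
        (_hnoise : BiasedSubGaussianMPC.NoiseModel ℙ 𝓕 S s)
        (_hloop : BiasedSubGaussianMPC.IsClosedLoop H D S s)
        (_hfeas : ∀ ω, BiasedSubGaussianMPC.MPCFeasible H D S 0 (s.xh 0 ω) (s.z 0 ω)),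
        (∀ t ω, BiasedSubGaussianMPC.MPCFeasible H D S t (s.xh t ω) (s.z t ω)) ∧
        (∀ t, ENNReal.ofReal (1 - S.delta) ≤
          ℙ {ω | Sum.elim (s.x t ω) (s.u t ω) ∈ BiasedSubGaussianMPC.stackSet S.X D.U}) ∧
        limsup (fun T : ℕ => (T : ℝ≥0∞)⁻¹ * ∑ t ∈ Finset.range T,
            ∫⁻ ω, ENNReal.ofReal (BiasedSubGaussianMPC.stageCost D (s.x t ω) (s.u t ω)) ∂ℙ) atTop
          ≤ ((κw (rw + rm) + κε (BiasedSubGaussianMPC.maxEigenvalue S.Seps).toNNReal : ℝ≥0) :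
              ℝ≥0∞) := by
  open BiasedSubGaussianMPC in
  obtain ⟨α, hs, hα0, hα, hα'⟩ := hSchur.exists_summable_bound
  obtain ⟨C, hC, havg⟩ := exists_limsup_average_le hs hα0 hα hα' hU hQ hR hP H
  have hK := isUnit_det_K hs hα
  have hL := isUnit_det_L hs hα'
  have hC2 : 0 < 2 * C.toNNReal := mul_pos two_pos (Real.toNNReal_pos.2 hC)
  -- These split `θ + θ²` at `θ = r + √σ`; the factor `2` absorbs the cross term of the square.
  refine ⟨fun r => 2 * C.toNNReal * (r + r ^ 2), fun r => 2 * C.toNNReal * (r + NNReal.sqrt r),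
    isKInfty_mul_add hC2 (by fun_prop) (fun a b hab => pow_le_pow_left' hab 2) (by simp),
    isKInfty_mul_add hC2 NNReal.continuous_sqrt NNReal.sqrt.monotone (by simp), ?_⟩
  intro S rw rm _ hW hM hSeps hsigma0 hdelta hterm Ω mΩ ℙ _ 𝓕 s hnoise hloop hfeas
  obtain ⟨ω₀⟩ := nonempty_of_isProbabilityMeasure ℙ
  -- The bounds on `W` and `M` are Euclidean while the estimates use the supremum norm, which is
  -- smaller.
  have hsup : ∀ x : Vec n, ‖x‖ ≤ ‖WithLp.toLp 2 x‖ := fun x =>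
    (pi_norm_le_iff_of_nonneg (norm_nonneg _)).2 fun i => PiLp.norm_apply_le (WithLp.toLp 2 x) i
  have hS : S.IsBounded D ((rw : ℝ) + rm) :=
    { W_nonempty := ⟨_, hnoise.w_mem 0 ω₀⟩
      M_nonempty := ⟨_, hnoise.m_mem 0 ω₀⟩
      W_le := fun w hw => (hsup w).trans ((hW w hw).trans (le_add_of_nonneg_right rm.2))
      M_le := fun m hm => (hsup m).trans ((hM m hm).trans (le_add_of_nonneg_left rw.2))
      delta_pos := hdelta.1
      delta_lt_one := hdelta.2
      terminal := hterm }
  have hrec : ∀ t ω, MPCFeasible H D S t (s.xh t ω) (s.z t ω) :=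
    fun t ω => hloop.mpcFeasible hterm (hfeas ω) t
  refine ⟨hrec, fun t => hloop.chance_constraint hnoise hK hL hSeps hsigma0 hdelta.1 hdelta.2
    (hrec t), (havg S _ hS hSeps ℙ 𝓕 s hnoise hloop hfeas).trans ?_⟩
  have hσ := (maxEigenvalue_bounds hSeps).1
  rewrite [← ENNReal.ofReal_coe_nnreal]
  refine ENNReal.ofReal_le_ofReal ?_
  push_cast
  rewrite [Real.coe_toNNReal _ hσ.le, Real.coe_toNNReal _ hC.le]
  have hσ2 : √(maxEigenvalue S.Seps) ^ 2 = maxEigenvalue S.Seps := Real.sq_sqrt hσ.le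
  set a : ℝ := (rw : ℝ) + rm
  have ha : 0 ≤ a := hS.nonneg
  set b := √(maxEigenvalue S.Seps)
  have hb : 0 ≤ b := Real.sqrt_nonneg _
  rewrite [← hσ2]
  have h1 : a + b + (a + b) ^ 2 ≤ 2 * (a + a ^ 2) + 2 * (b ^ 2 + b) := by
    nlinarith [sq_nonneg (a - b)]
  have h2 := mul_le_mul_of_nonneg_left h1 hC.le
  linarith
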